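/- **Setting.** Let $\Sigma=\mathbb{Z}_{\ge 0}^{\mathbb{Z}}$ with the product $\sigma$-algebra and the coordinatewise order $\preccurlyeq$. For $\eta\in\Sigma$ and a finite set $I\subset\mathbb Z$ write $\eta(I)=\sum_{x\in I}\eta(x)$. For integers $a\le b$, $[a,b]$ denotes $\{a,\dots,b\}$, an interval of length $|[a,b]|=b-a+1$. The time set $T$ is $\mathbb{Z}_{\ge0}$ or $[0,\infty)$ (more generally, the positive cone of a linearly ordered commutative ring). A coupling of two probability measures is a probability measure on the product space with these marginals. An *environment* consists of a non-empty bounded open interval $J\subseteq[0,\infty)$, probability measures $(\mu_\rho)_{\rho\in J}$ on $\Sigma$, and probability measures $(\mathbf P^{\eta_0})_{\eta_0\in\Sigma}$ on $\Sigma^{T}$, measurable in $\eta_0$, with $\eta_{t=0}=\eta_0$ $\mathbf P^{\eta_0}$-a.s. Put $\mathbf P^\rho=\int\mu_\rho(d\eta_0)\,\mathbf P^{\eta_0}$. It is required that: 1. (Markov property and invariance) under every $\mathbf P^{\eta_0}$, for all $s\in T$ and $x\in\mathbb Z$, conditionally on $(\eta_u)_{u\le s}$ the process $(\eta_{s+t}(x+\cdot))_{t}$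 has law $\mathbf P^{\eta_s(x+\cdot)}$; each $\mu_\rho$ is invariant under translations of $\mathbb Z$; 2. (stationarity) for all $\rho\in J$ and $s\in T$, $(\eta_{s+t})_t$ has the same law as $(\eta_t)_t$ under $\mathbf P^\rho$; 3. (monotonicity) if $\eta_0'\preccurlyeq\eta_0$, there is a coupling of $\mathbf P^{\eta_0'}$ and $\mathbf P^{\eta_0}$ with $\eta'_t\preccurlyeq\eta_t$ a.s. for every $t\in T$; if $\rho'\le\rho$ in $J$, there is a coupling of $\mu_{\rho'}$ and $\mu_\rho$ which is a.s. supported on $\{\eta'\preccurlyeq\eta\}$; 4. (density) there is $c_1>0$ such that for all $\rho\in J$, $\varepsilon\in(0,1)$ and integers $\ell\ge1$, $\mu_\rho\big(|\eta([0,\ell-1])-\rho\ell|\ge\varepsilon\ell\big)\le 2\exp(-c_1\varepsilon^2\ell)$. Let $\nu>0$. Consider two further conditions (if $T$ is uncountable, $\mathbb Q$ of an event is understood as outer measure). * *(No particle drifting in from the side.)* For all integers $t,H\ge0$, $k\ge1$ and all $\eta_0,\eta_0'\in\Sigma$ with $\eta_0\succcurlyeq\eta_0'$ on $[-H,H]$,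 there is a coupling $\mathbb Q$ of $\eta\sim\mathbf P^{\eta_0}$ and $\eta'\sim\mathbf P^{\eta_0'}$ such that $$\mathbb Q\big(\forall s\in T,\ s\le t,\ \forall x\in\mathbb Z,\ |x|\le H-2\nu kt:\ \eta_s(x)\ge\eta'_s(x)\big)\ge1-20e^{-k\nu t/4}.$$ * *(Covering.)* There are $C,C'>0$ such that for all $\rho\in J$, $\varepsilon\in(0,1)$ with $\rho+\varepsilon\in J$, and all integers $H,t\ge1$ with $H>4\nu t$, $\nu^8t>1$ and $\nu t^{1/4}>C\varepsilon^{-2}(1+|\log^3(\nu t)|)$, the following holds with $\ell=\lfloor t^{1/4}\rfloor$. If $\eta_0,\eta'_0\in\Sigma$ satisfy $\eta_0(I)\ge(\rho+3\varepsilon/4)|I|$ and $\eta_0'(I)\le(\rho+\varepsilon/4)|I|$ for every interval $I\subseteq[-H,H]$ with $\lfloor\ell/2\rfloor\le|I|\le\ell$, there is a coupling $\mathbb Q$ of $\eta\sim\mathbf P^{\eta_0}$ and $\eta'\sim\mathbf P^{\eta_0'}$ such that $$\mathbb Q\big(\forall x\in\mathbb Z,\ |x|\le H-4\nu t:\ \eta_t(x)\ge\eta'_t(x)\big)\ge1-C'tH\exp\big(-(C'(1+\nu^{-1}))^{-1}\varepsilon^2t^{1/4}\big).$$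 *The walk.* Let $0\le p_\circ<p_\bullet\le1$. Given $\eta$ and i.i.d. uniform variables $(U_n)_{n\ge0}$ on $[0,1]$ independent of $\eta$, let $X_0=0$ and $$X_{n+1}=X_n+2\cdot\mathbf 1\{U_n\le(p_\circ-p_\bullet)\mathbf 1\{\eta_n(X_n)=0\}+p_\bullet\}-1 .$$ $\mathbb P^\rho$ denotes the (annealed) law when $\eta\sim\mathbf P^\rho$, with expectation $\mathbb E^\rho$. For $\rho\in J$, $L\ge1$ let $v(\rho,L)=\mathbb E^\rho[X_L/L]$; let $\bar J$ be the set of $\rho\in J$ for which $v(\rho)=\lim_{L\to\infty}v(\rho,L)$ exists; and let $$v^-(\rho)=\lim_{\rho'\uparrow\rho,\ \rho'\in\bar J,\ \rho'<\rho}v(\rho'),\qquad v^+(\rho)=\lim_{\rho'\downarrow\rho,\ \rho'\in\bar J,\ \rho'>\rho}v(\rho').$$ **Corollary 4.3.** Consider an environment which satisfies the two further conditions above for some $\nu>0$, and let $\rho\in J$. Then $\rho$ is an accumulation point of $\bar J$ from both sides, the limits $v^-(\rho)$ and $v^+(\rho)$ exist, and: * for every $v_\star\in(0,v^-(\rho))$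 there is $c>0$ such that for all sufficiently large $K\in\mathbb N$, $$\mathbb P^\rho\big(\exists n\in\mathbb N:\ X_n<nv_\star-K\big)\le2\exp\big(-cK^{1/1000}\big);$$ * for every $v_\star\in(v^+(\rho),1)$ there is $c>0$ such that for all sufficiently large $K\in\mathbb N$, $$\mathbb P^\rho\big(\exists n\in\mathbb N:\ X_n>nv_\star+K\big)\le2\exp\big(-cK^{1/1000}\big).$$ -/

import Mathlib

open MeasureTheory ProbabilityTheory Filter Topology Set

namespace RWDRE

noncomputable section

/-- Particle configurations: `η x` is the number of particles at the site `x`. They carry the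
product σ-algebra and the pointwise order. -/
abbrev Config : Type := ℤ → ℕ

/-- Trajectories of the environment, indexed by a time set `T` (`ℕ` for discrete time, `ℝ≥0` for
continuous time), with the product σ-algebra. -/
abbrev EnvPath (T : Type) : Type := T → Config

/-- `η(x + ·)`. -/
def translate (x : ℤ) (η : Config) : Config := fun y => η (x + y)

/-- `(η_{s+t}(x + ·))_{t ≥ 0}`. -/
def shift {T : Type} [Add T] (s : T) (x : ℤ) (η : EnvPath T) : EnvPath T :=
  fun t => translate x (η (s + t))

/-- The σ-algebra generated by `η_u`, `u ≤ s`. -/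
@[reducible]
def past {T : Type} [LE T] (s : T) : MeasurableSpace (EnvPath T) :=
  ⨆ u : {u : T // u ≤ s}, MeasurableSpace.comap (fun η : EnvPath T => η u) inferInstance

/-- `η([a, b])`, the number of particles in the integer interval `[a, b]`. -/
def count (η : Config) (a b : ℤ) : ℕ := ∑ x ∈ Finset.Icc a b, η x

/-- `Q` is a coupling of `m₁` and `m₂`. -/
def IsCoupling {A B : Type} [MeasurableSpace A] [MeasurableSpace B]
    (Q : Measure (A × B)) (m₁ : Measure A) (m₂ : Measure B) : Prop :=
  Q.map Prod.fst = m₁ ∧ Q.map Prod.snd = m₂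

/-- A dynamic random environment over the time set `T`, for densities in the bounded open interval
`(lo, hi)`: the initial laws `μ ρ`, and the laws `P η₀` of the environment started from `η₀`. -/
structure Environment (T : Type) [CommSemiring T] [LinearOrder T] where
  lo : ℝ
  hi : ℝ
  lo_nonneg : 0 ≤ lo
  lo_lt_hi : lo < hi
  μ : ℝ → Measure Config
  P : Kernel Config (EnvPath T)
  isProbabilityMeasure_μ : ∀ ρ ∈ Ioo lo hi, IsProbabilityMeasure (μ ρ)
  isMarkovKernel_P : IsMarkovKernel P
  /-- under `P η₀` the environment starts from `η₀` -/
  start : ∀ η₀ : Config, ∀ᵐ η ∂(P η₀), η 0 = η₀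
  /-- Markov property, time homogeneity and translation invariance of the dynamics: given the past
  up to time `s`, the process `(η_{s+t}(x + ·))_t` has law `P (η_s(x + ·))` -/
  markov : ∀ (η₀ : Config) (s : T) (x : ℤ) (A B : Set (EnvPath T)),
    MeasurableSet[past s] A → MeasurableSet B →
    P η₀ (A ∩ shift s x ⁻¹' B) = ∫⁻ η in A, P (translate x (η s)) B ∂(P η₀)
  /-- translation invariance of the initial laws -/
  map_translate_μ : ∀ ρ ∈ Ioo lo hi, ∀ x : ℤ, (μ ρ).map (translate x) = μ ρ
  /-- stationarity -/
  stationary : ∀ ρ ∈ Ioo lo hi, ∀ s : T,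
    ((μ ρ).bind P).map (shift s 0) = (μ ρ).bind P
  /-- quenched monotonicity -/
  monotone_quenched : ∀ η₀' η₀ : Config, η₀' ≤ η₀ →
    ∃ Q : Measure (EnvPath T × EnvPath T), IsCoupling Q (P η₀') (P η₀) ∧
      ∀ t : T, ∀ᵐ ω ∂Q, ω.1 t ≤ ω.2 t
  /-- annealed monotonicity -/
  monotone_annealed : ∀ ρ' ∈ Ioo lo hi, ∀ ρ ∈ Ioo lo hi, ρ' ≤ ρ →
    ∃ Q : Measure (Config × Config), IsCoupling Q (μ ρ') (μ ρ) ∧ ∀ᵐ ω ∂Q, ω.1 ≤ ω.2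
  /-- density at stationarity -/
  density : ∃ c : ℝ, 0 < c ∧ ∀ ρ ∈ Ioo lo hi, ∀ ε ∈ Ioo (0 : ℝ) 1, ∀ ℓ : ℕ, 1 ≤ ℓ →
    (μ ρ).real {η | ε * ℓ ≤ |(count η 0 ((ℓ : ℤ) - 1) : ℝ) - ρ * ℓ|}
      ≤ 2 * Real.exp (-c * ε ^ 2 * ℓ)

namespace Environment

variable {T : Type} [CommSemiring T] [LinearOrder T] (E : Environment T)

/-- The interval of densities. -/
def J : Set ℝ := Ioo E.lo E.hi

/-- No particle drifting in from the side, for an environment of activity rate `ν`: domination on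
`[-H, H]` at time `0` persists up to time `t` on `[-H + 2νkt, H - 2νkt]`. -/
def NoDriftingIn (ν : ℝ) : Prop :=
  ∀ (t H k : ℕ), 1 ≤ k → ∀ η₀ η₀' : Config,
    (∀ x : ℤ, |x| ≤ (H : ℤ) → η₀' x ≤ η₀ x) →
    ∃ Q : Measure (EnvPath T × EnvPath T), IsCoupling Q (E.P η₀) (E.P η₀') ∧
      1 - 20 * Real.exp (-(k * ν * t / 4)) ≤
        Q.real {ω | ∀ s : T, s ≤ (t : T) → ∀ x : ℤ, |(x : ℝ)| ≤ H - 2 * ν * k * t →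
          ω.2 s x ≤ ω.1 s x}

/-- Covering of `η'` by `η`, for an environment of activity rate `ν`: if `η₀` has a slightly larger
empirical density than `η₀'` on `[-H, H]`, on all intervals of length between `⌊ℓ/2⌋` and `ℓ` with
`ℓ = ⌊t^{1/4}⌋`, then `η_t` can be made to dominate `η'_t` on `[-H + 4νt, H - 4νt]`. -/
def Covering (ν : ℝ) : Prop :=
  ∃ C C' : ℝ, 0 < C ∧ 0 < C' ∧ ∀ ρ ∈ E.J, ∀ ε ∈ Ioo (0 : ℝ) 1, ρ + ε ∈ E.J →
    ∀ H t : ℕ, 1 ≤ H → 1 ≤ t → 4 * ν * t < H → 1 < ν ^ 8 * t →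
      C * (ε ^ 2)⁻¹ * (1 + |Real.log (ν * t) ^ 3|) < ν * (t : ℝ) ^ (1 / 4 : ℝ) →
    ∀ η₀ η₀' : Config,
      (∀ a b : ℤ, -(H : ℤ) ≤ a → a ≤ b → b ≤ H →
        ⌊(t : ℝ) ^ (1 / 4 : ℝ)⌋ / 2 ≤ b - a + 1 → b - a + 1 ≤ ⌊(t : ℝ) ^ (1 / 4 : ℝ)⌋ →
          (ρ + 3 * ε / 4) * ((b - a + 1 : ℤ) : ℝ) ≤ count η₀ a b ∧
          (count η₀' a b : ℝ) ≤ (ρ + ε / 4) * ((b - a + 1 : ℤ) : ℝ)) →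
      ∃ Q : Measure (EnvPath T × EnvPath T), IsCoupling Q (E.P η₀) (E.P η₀') ∧
        1 - C' * t * H * Real.exp (-((C' * (1 + ν⁻¹))⁻¹ * ε ^ 2 * (t : ℝ) ^ (1 / 4 : ℝ))) ≤
          Q.real {ω | ∀ x : ℤ, |(x : ℝ)| ≤ H - 4 * ν * t →
            ω.2 (t : T) x ≤ ω.1 (t : T) x}

end Environment

/-- The random walk on the environment `η`, started from the origin at time `0` and driven by the
variables `u 0, u 1, …`: it jumps to the right when `u n ≤ p₁` if its site is occupied, and when
`u n ≤ p₀` if its site is empty; it jumps to the left otherwise. -/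
def walk {T : Type} [CommSemiring T] (p₀ p₁ : ℝ) (η : EnvPath T) (u : ℕ → ℝ) : ℕ → ℤ
  | 0 => 0
  | n + 1 => walk p₀ p₁ η u n +
      2 * (if u n ≤ (p₀ - p₁) * (if η (n : T) (walk p₀ p₁ η u n) = 0 then 1 else 0) + p₁
        then 1 else 0) - 1

/-- The law of a sequence of i.i.d. uniform variables on `[0, 1]`. -/
def uniforms : Measure (ℕ → ℝ) :=
  Measure.infinitePi (fun _ : ℕ => (volume.restrict (Icc (0 : ℝ) 1) : Measure ℝ))

namespace Environment

variable {T : Type} [CommSemiring T] [LinearOrder T] (E : Environment T)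

/-- The annealed law at density `ρ`, as the joint law of the environment started from `μ ρ` and of
the independent uniform variables which drive the walk. -/
def annealed (ρ : ℝ) : Measure (EnvPath T × (ℕ → ℝ)) :=
  ((E.μ ρ).bind E.P).prod uniforms

/-- `v(ρ, L)`, the expectation of `X_L / L` at density `ρ`. -/
def meanSpeed (p₀ p₁ ρ : ℝ) (L : ℕ) : ℝ :=
  ∫ ω, (walk p₀ p₁ ω.1 ω.2 L : ℝ) / L ∂(E.annealed ρ)

/-- The densities `ρ` in `J` for which `v(ρ) = lim_L v(ρ, L)` exists. -/
def regularDensities (p₀ p₁ : ℝ) : Set ℝ :=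
  {ρ | ρ ∈ E.J ∧ ∃ v : ℝ, Tendsto (E.meanSpeed p₀ p₁ ρ) atTop (𝓝 v)}

/-- `v(ρ) = lim_L v(ρ, L)`; only used at densities for which the limit exists. -/
def speed (p₀ p₁ ρ : ℝ) : ℝ := limUnder atTop (E.meanSpeed p₀ p₁ ρ)

/-- `v` is the limit of `v(ρ')` as `ρ'` increases strictly to `ρ` through densities at which it
is defined, and there are such densities arbitrarily close to `ρ`. -/
def IsLowerSpeed (p₀ p₁ ρ v : ℝ) : Prop :=
  (𝓝[E.regularDensities p₀ p₁ ∩ Iio ρ] ρ).NeBot ∧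
    Tendsto (E.speed p₀ p₁) (𝓝[E.regularDensities p₀ p₁ ∩ Iio ρ] ρ) (𝓝 v)

/-- `v` is the limit of `v(ρ')` as `ρ'` decreases strictly to `ρ` through densities at which it
is defined, and there are such densities arbitrarily close to `ρ`. -/
def IsUpperSpeed (p₀ p₁ ρ v : ℝ) : Prop :=
  (𝓝[E.regularDensities p₀ p₁ ∩ Ioi ρ] ρ).NeBot ∧
    Tendsto (E.speed p₀ p₁) (𝓝[E.regularDensities p₀ p₁ ∩ Ioi ρ] ρ) (𝓝 v)

end Environment

end

end RWDRE

/-!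
The walk *refreshes* its environment. During `√L` steps it moves by at most `√L`, while by the
covering coupling the environment at density `ρ` gets dominated by an independent stationary one at
a slightly larger density `ρ'`. As the walk is monotone in the environment on each parity class, its
increment over `√L + L` steps at density `ρ` is dominated, up to a tiny error, by `√L` plus an
independent copy of `X_L` at density `ρ'`; symmetrically from below.

Iterating this over the blocks of a longer time `N` and averaging, then letting `N` and `L` run
through the scales `L, L ^ 2, L ^ 4, …` with densities increasing by a summable amount, one finds
that the upper speed at `ρ` is at most the lower speed at `ρ'` whenever `ρ < ρ'`. So the lower speed
is nondecreasing, and the speed exists at its continuity points, which are dense.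

With exponential moments in place of means, the same iteration with `L = p ^ 40` over about `p`
blocks bounds the probability of a deviation at time `N ≈ p ^ 41` by `exp (-c p)`; summing over all
times gives the stretched exponential tail. Lower deviations follow by reflection.
-/

namespace RWDRE

noncomputable section

/-! ### The quenched semigroup -/

section Quenched

/-- The rates of a walk which jumps to the right with probability `p₀` from an empty site and with
the larger probability `p₁` from an occupied one. -/
structure JumpRates (p₀ p₁ : ℝ) : Prop where
  nonneg : 0 ≤ p₀
  le : p₀ ≤ p₁
  le_one : p₁ ≤ 1

/-- The probability of a jump to the right from a site with `m` particles. -/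
def jumpProb (p₀ p₁ : ℝ) (m : ℕ) : ℝ := if m = 0 then p₀ else p₁

/-- The one-step transition operator of the walk in the configuration `ζ`. -/
def jump (p₀ p₁ : ℝ) (ζ : Config) (Φ : ℤ → ℝ) (x : ℤ) : ℝ :=
  jumpProb p₀ p₁ (ζ x) * Φ (x + 1) + (1 - jumpProb p₀ p₁ (ζ x)) * Φ (x - 1)

/-- The quenched semigroup: `quenched p₀ p₁ η n Φ x` is the expectation of `Φ (X n)` for the walk
started from `x` in the fixed environment `η`. -/
def quenched {T : Type} [CommSemiring T] (p₀ p₁ : ℝ) (η : EnvPath T) :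
    ℕ → (ℤ → ℝ) → ℤ → ℝ
  | 0, Φ => Φ
  | n + 1, Φ => quenched p₀ p₁ η n (jump p₀ p₁ (η n) Φ)

variable {T : Type} [CommSemiring T] {p₀ p₁ : ℝ}

lemma jumpProb_mem_Icc (hp : JumpRates p₀ p₁) (m : ℕ) : jumpProb p₀ p₁ m ∈ Icc (0 : ℝ) 1 := by
  obtain ⟨h₀, h, h₁⟩ := hp
  unfold jumpProb
  split_ifs <;> constructor <;> linarith

lemma monotone_jumpProb (hp : p₀ ≤ p₁) : Monotone (jumpProb p₀ p₁) := by
  intro m m' h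
  unfold jumpProb
  split_ifs <;> first | linarith | omega

lemma jump_mono (hp : JumpRates p₀ p₁) (ζ : Config) {Φ Ψ : ℤ → ℝ} {x : ℤ}
    (hr : Φ (x + 1) ≤ Ψ (x + 1)) (hl : Φ (x - 1) ≤ Ψ (x - 1)) :
    jump p₀ p₁ ζ Φ x ≤ jump p₀ p₁ ζ Ψ x :=
  add_le_add (mul_le_mul_of_nonneg_left hr (jumpProb_mem_Icc hp _).1)
    (mul_le_mul_of_nonneg_left hl (sub_nonneg.2 (jumpProb_mem_Icc hp _).2))

lemma jump_mem (hp : JumpRates p₀ p₁) (ζ : Config) {s : Set ℝ} (hs : Convex ℝ s) {Φ : ℤ → ℝ}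
    (hΦ : ∀ x, Φ x ∈ s) (x : ℤ) : jump p₀ p₁ ζ Φ x ∈ s :=
  hs (hΦ _) (hΦ _) (jumpProb_mem_Icc hp _).1 (sub_nonneg.2 (jumpProb_mem_Icc hp _).2)
    (add_sub_cancel _ _)

lemma quenched_mem (hp : JumpRates p₀ p₁) (η : EnvPath T) (n : ℕ) {s : Set ℝ} (hs : Convex ℝ s)
    {Φ : ℤ → ℝ} (hΦ : ∀ x, Φ x ∈ s) (x : ℤ) : quenched p₀ p₁ η n Φ x ∈ s := by
  induction n generalizing Φ with
  | zero => exact hΦ x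
  | succ n ih => exact ih (jump_mem hp _ hs hΦ)

lemma quenched_neg (η : EnvPath T) (n : ℕ) (Φ : ℤ → ℝ) (x : ℤ) :
    quenched p₀ p₁ η n (fun y => -Φ y) x = -quenched p₀ p₁ η n Φ x := by
  induction n generalizing Φ with
  | zero => rfl
  | succ n ih =>
    rw [quenched, quenched, ← ih]
    congr 1
    funext y
    simp only [jump]
    ring

lemma quenched_add_const (η : EnvPath T) (n : ℕ) (Φ : ℤ → ℝ) (c : ℝ) (x : ℤ) :
    quenched p₀ p₁ η n (fun y => Φ y + c) x = quenched p₀ p₁ η n Φ x + c := by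
  induction n generalizing Φ with
  | zero => rfl
  | succ n ih =>
    rw [quenched, quenched, ← ih]
    congr 1
    funext y
    simp only [jump]
    ring

lemma quenched_mono (hp : JumpRates p₀ p₁) (η : EnvPath T) (n : ℕ) {Φ Ψ : ℤ → ℝ} {x : ℤ}
    (h : ∀ y, |y - x| ≤ n → Φ y ≤ Ψ y) :
    quenched p₀ p₁ η n Φ x ≤ quenched p₀ p₁ η n Ψ x := by
  induction n generalizing Φ Ψ with
  | zero => exact h x (by simp)
  | succ n ih =>
    refine ih fun y hy => ?_
    rw [abs_le] at hy
    exact jump_mono hp _ (h _ (by rw [abs_le]; push_cast; omega))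
      (h _ (by rw [abs_le]; push_cast; omega))

lemma quenched_add (η : EnvPath T) (n m : ℕ) (Φ : ℤ → ℝ) :
    quenched p₀ p₁ η (n + m) Φ
      = quenched p₀ p₁ η n (quenched p₀ p₁ (shift (n : T) 0 η) m Φ) := by
  induction m generalizing Φ with
  | zero => rfl
  | succ m ih =>
    rw [← add_assoc, quenched, ih, quenched]
    congr 3
    funext y
    simp only [shift, translate, Nat.cast_add, zero_add]

lemma quenched_shift_zero (η : EnvPath T) (n : ℕ) (Φ : ℤ → ℝ) (x y : ℤ) :
    quenched p₀ p₁ (shift 0 x η) n (fun z => Φ (x + z)) y = quenched p₀ p₁ η n Φ (x + y) := by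
  induction n generalizing Φ with
  | zero => rfl
  | succ n ih =>
    rw [quenched, quenched, ← ih]
    congr 1
    funext z
    simp only [jump, shift, translate, zero_add, add_assoc, add_sub_assoc]

lemma quenched_congr_env {η η' : EnvPath T} {n : ℕ} (h : ∀ j < n, η (j : T) = η' j) (Φ : ℤ → ℝ) :
    quenched p₀ p₁ η n Φ = quenched p₀ p₁ η' n Φ := by
  induction n generalizing Φ with
  | zero => rfl
  | succ n ih => rw [quenched, quenched, h n (by omega), ih fun j hj => h j (by omega)]

/-- Functions which are nondecreasing on each of the two parity classes; the semigroup preserves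
this class, whereas it does not preserve monotone functions. -/
def ParityMono (Φ : ℤ → ℝ) : Prop := ∀ x, Φ x ≤ Φ (x + 2)

namespace ParityMono

variable {Φ : ℤ → ℝ}

lemma of_monotone (hΦ : Monotone Φ) : ParityMono Φ := fun _ => hΦ (by omega)

lemma sub_one_le_add_one (hΦ : ParityMono Φ) (x : ℤ) : Φ (x - 1) ≤ Φ (x + 1) := by
  simpa only [show x - 1 + 2 = x + 1 by ring] using hΦ (x - 1)

lemma jump_mem_Icc (hp : JumpRates p₀ p₁) (ζ : Config) (hΦ : ParityMono Φ) (x : ℤ) :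
    jump p₀ p₁ ζ Φ x ∈ Icc (Φ (x - 1)) (Φ (x + 1)) :=
  have hle := hΦ.sub_one_le_add_one x
  convex_Icc _ _ ⟨hle, le_rfl⟩ ⟨le_rfl, hle⟩ (jumpProb_mem_Icc hp _).1
    (sub_nonneg.2 (jumpProb_mem_Icc hp _).2) (add_sub_cancel _ _)

protected lemma jump (hp : JumpRates p₀ p₁) (ζ : Config) (hΦ : ParityMono Φ) :
    ParityMono (jump p₀ p₁ ζ Φ) := fun x =>
  calc RWDRE.jump p₀ p₁ ζ Φ x ≤ Φ (x + 1) := (hΦ.jump_mem_Icc hp ζ x).2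
    _ = Φ (x + 2 - 1) := by ring_nf
    _ ≤ RWDRE.jump p₀ p₁ ζ Φ (x + 2) := (hΦ.jump_mem_Icc hp ζ (x + 2)).1

protected lemma quenched (hp : JumpRates p₀ p₁) (η : EnvPath T) (n : ℕ) (hΦ : ParityMono Φ) :
    ParityMono (quenched p₀ p₁ η n Φ) := by
  induction n generalizing Φ with
  | zero => exact hΦ
  | succ n ih => exact ih (hΦ.jump hp _)

lemma quenched_mem_Icc (hp : JumpRates p₀ p₁) (η : EnvPath T) (n : ℕ) (hΦ : ParityMono Φ)
    (x : ℤ) : RWDRE.quenched p₀ p₁ η n Φ x ∈ Icc (Φ (x - n)) (Φ (x + n)) := by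
  induction n generalizing Φ with
  | zero => simp [RWDRE.quenched]
  | succ n ih =>
    rw [show x - (n + 1 : ℕ) = x - n - 1 by push_cast; ring,
      show x + (n + 1 : ℕ) = x + n + 1 by push_cast; ring]
    exact Icc_subset_Icc (hΦ.jump_mem_Icc hp _ _).1 (hΦ.jump_mem_Icc hp _ _).2
      (ih (hΦ.jump hp _))

lemma jump_mono_env (hp : p₀ ≤ p₁) (hΦ : ParityMono Φ) {ζ ζ' : Config} {x : ℤ}
    (h : ζ x ≤ ζ' x) : RWDRE.jump p₀ p₁ ζ Φ x ≤ RWDRE.jump p₀ p₁ ζ' Φ x := by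
  have := mul_le_mul_of_nonneg_right (monotone_jumpProb hp h)
    (sub_nonneg.2 (hΦ.sub_one_le_add_one x))
  simp only [RWDRE.jump]
  linarith

lemma quenched_mono_env (hp : JumpRates p₀ p₁) {η η' : EnvPath T} (n : ℕ) (hΦ : ParityMono Φ)
    {x : ℤ} (h : ∀ j : ℕ, j < n → ∀ y, |y - x| ≤ n → η j y ≤ η' j y) :
    RWDRE.quenched p₀ p₁ η n Φ x ≤ RWDRE.quenched p₀ p₁ η' n Φ x := by
  induction n generalizing Φ with
  | zero => exact le_rfl
  | succ n ih =>
    calc RWDRE.quenched p₀ p₁ η n (RWDRE.jump p₀ p₁ (η n) Φ) x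
        ≤ RWDRE.quenched p₀ p₁ η n (RWDRE.jump p₀ p₁ (η' n) Φ) x :=
          quenched_mono hp η n fun y hy =>
            hΦ.jump_mono_env hp.le (h n (by omega) y (by push_cast; omega))
      _ ≤ RWDRE.quenched p₀ p₁ η' n (RWDRE.jump p₀ p₁ (η' n) Φ) x :=
          ih (hΦ.jump hp _) fun j hj y hy => h j (by omega) y (by push_cast; omega)

end ParityMono

lemma integral_quenched {α : Type*} [MeasurableSpace α] {m : Measure α} (η : EnvPath T) (n : ℕ)
    {Φ : α → ℤ → ℝ} (hΦ : ∀ x, Integrable (fun a => Φ a x) m) (x : ℤ) :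
    ∫ a, quenched p₀ p₁ η n (Φ a) x ∂m = quenched p₀ p₁ η n (fun y => ∫ a, Φ a y ∂m) x := by
  induction n generalizing Φ with
  | zero => rfl
  | succ n ih =>
    have hjump : ∀ y, Integrable (fun a => jump p₀ p₁ (η n) (Φ a) y) m :=
      fun y => ((hΦ _).const_mul _).add ((hΦ _).const_mul _)
    simp only [quenched]
    rw [ih hjump]
    congr 1
    funext y
    simp only [jump]
    rw [integral_add ((hΦ _).const_mul _) ((hΦ _).const_mul _), integral_const_mul,
      integral_const_mul]

end Quenched

/-! ### Measurability -/

section Measurability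

variable {T : Type} [CommSemiring T] {p₀ p₁ : ℝ}

lemma measurable_eval_apply {α : Type*} [MeasurableSpace α] {f : α → Config} {g : α → ℤ}
    (hf : Measurable f) (hg : Measurable g) : Measurable fun a => f a (g a) := by
  have : Measurable fun p : Config × ℤ => p.1 p.2 :=
    measurable_from_prod_countable_left fun x => measurable_pi_apply x
  exact this.comp (hf.prodMk hg)

lemma measurable_translate (x : ℤ) : Measurable (translate x) :=
  measurable_pi_lambda _ fun _ => measurable_pi_apply _

lemma measurable_shift (s : T) (x : ℤ) : Measurable (shift s x : EnvPath T → EnvPath T) :=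
  measurable_pi_lambda _ fun _ => (measurable_translate x).comp (measurable_pi_apply _)

lemma measurable_count (a b : ℤ) : Measurable fun ζ : Config => count ζ a b :=
  Finset.measurable_sum _ fun x _ => measurable_pi_apply x

lemma measurable_jumpProb : Measurable (jumpProb p₀ p₁) := measurable_from_nat

lemma measurable_jump {α : Type*} [MeasurableSpace α] {f : α → Config} (hf : Measurable f)
    {Φ : α → ℤ → ℝ} (hΦ : ∀ x, Measurable fun a => Φ a x) (x : ℤ) :
    Measurable fun a => jump p₀ p₁ (f a) (Φ a) x := by
  have hprob : Measurable fun a => jumpProb p₀ p₁ (f a x) :=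
    measurable_jumpProb.comp ((measurable_pi_apply x).comp hf)
  exact (hprob.mul (hΦ _)).add ((measurable_const.sub hprob).mul (hΦ _))

lemma measurable_quenched_comp {α : Type*} [MeasurableSpace α] {f : α → EnvPath T}
    (hf : Measurable f) (n : ℕ) {Φ : α → ℤ → ℝ} (hΦ : ∀ x, Measurable fun a => Φ a x) (x : ℤ) :
    Measurable fun a => quenched p₀ p₁ (f a) n (Φ a) x := by
  induction n generalizing Φ with
  | zero => exact hΦ x
  | succ n ih => exact ih fun y => measurable_jump ((measurable_pi_apply _).comp hf) hΦ y

lemma measurable_quenched (n : ℕ) (Φ : ℤ → ℝ) (x : ℤ) :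
    Measurable fun η : EnvPath T => quenched p₀ p₁ η n Φ x :=
  measurable_quenched_comp (f := fun η => η) (Φ := fun _ => Φ) measurable_id n
    (fun _ => measurable_const) x

lemma integrable_quenched {m : Measure (EnvPath T)} [IsFiniteMeasure m] (hp : JumpRates p₀ p₁)
    (n : ℕ) {Φ : ℤ → ℝ} {a b : ℝ} (hΦ : ∀ x, Φ x ∈ Icc a b) (x : ℤ) :
    Integrable (fun η => quenched p₀ p₁ η n Φ x) m :=
  .of_mem_Icc a b (measurable_quenched n Φ x).aemeasurable
    (ae_of_all _ fun η => quenched_mem hp η n (convex_Icc a b) hΦ x)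

end Measurability

/-! ### The walk driven by uniform variables -/

section Walk

variable {T : Type} [CommSemiring T] {p₀ p₁ : ℝ}

instance isProbabilityMeasure_unitInterval :
    IsProbabilityMeasure (volume.restrict (Icc (0 : ℝ) 1)) := ⟨by simp⟩

instance isProbabilityMeasure_uniforms : IsProbabilityMeasure uniforms := by
  unfold uniforms; infer_instance

lemma walk_succ (η : EnvPath T) (u : ℕ → ℝ) (n : ℕ) :
    walk p₀ p₁ η u (n + 1) = if u n ≤ jumpProb p₀ p₁ (η (n : T) (walk p₀ p₁ η u n))
      then walk p₀ p₁ η u n + 1 else walk p₀ p₁ η u n - 1 := by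
  rw [walk, jumpProb]
  by_cases h : η (n : T) (walk p₀ p₁ η u n) = 0
  · simp only [h, if_true, mul_one, sub_add_cancel]
    split_ifs <;> ring
  · simp only [h, if_false, mul_zero, zero_add]
    split_ifs <;> ring

lemma walk_congr (η : EnvPath T) {u u' : ℕ → ℝ} {n : ℕ} (h : ∀ i < n, u i = u' i) :
    walk p₀ p₁ η u n = walk p₀ p₁ η u' n := by
  induction n with
  | zero => rfl
  | succ n ih => rw [walk_succ, walk_succ, ih fun i hi => h i (by omega), h n (by omega)]

lemma abs_walk_le (η : EnvPath T) (u : ℕ → ℝ) (n : ℕ) : |walk p₀ p₁ η u n| ≤ n := by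
  induction n with
  | zero => simp [walk]
  | succ n ih =>
    rw [abs_le] at *
    rw [walk_succ]
    push_cast
    split_ifs <;> omega

lemma measurable_walk (n : ℕ) :
    Measurable fun ω : EnvPath T × (ℕ → ℝ) => walk p₀ p₁ ω.1 ω.2 n := by
  induction n with
  | zero => exact measurable_const
  | succ n ih =>
    simp only [walk_succ]
    refine Measurable.ite (measurableSet_le ((measurable_pi_apply n).comp measurable_snd) ?_)
      (ih.add_const 1) (ih.sub_const 1)
    exact measurable_jumpProb.comp
      (measurable_eval_apply ((measurable_pi_apply _).comp measurable_fst) ih)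

lemma measurable_walk_right (η : EnvPath T) (n : ℕ) :
    Measurable fun u : ℕ → ℝ => walk p₀ p₁ η u n :=
  (measurable_walk n).comp measurable_prodMk_left

lemma indepFun_walk (η : EnvPath T) (n : ℕ) :
    IndepFun (fun u => walk p₀ p₁ η u n) (fun u => u n) uniforms := by
  have hindep : IndepFun (fun u (i : Finset.range n) => u i) (fun u (i : ({n} : Finset ℕ)) => u i)
      uniforms :=
    (iIndepFun_infinitePi (P := fun _ : ℕ => volume.restrict (Icc (0 : ℝ) 1))
      (X := fun _ x => x) (fun _ => measurable_id)).indepFun_finset (Finset.range n) {n} (by simp)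
      measurable_pi_apply
  let extend : (Finset.range n → ℝ) → ℕ → ℝ :=
    fun w i => if hi : i ∈ Finset.range n then w ⟨i, hi⟩ else 0
  have hextend : Measurable extend := measurable_pi_lambda _ fun i => by
    by_cases hi : i ∈ Finset.range n
    · simpa only [extend, hi, dif_pos] using measurable_pi_apply _
    · simp only [extend, hi, dif_neg, not_false_eq_true, measurable_const]
  refine (hindep.comp ((measurable_walk_right (p₀ := p₀) (p₁ := p₁) η n).comp hextend)
    (measurable_pi_apply (⟨n, by simp⟩ : ({n} : Finset ℕ)))).congr (ae_of_all _ fun u => ?_) .rfl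
  exact walk_congr η fun i hi => by simp [extend, hi]

lemma map_walk_prodMk_uniforms (η : EnvPath T) (n : ℕ) :
    uniforms.map (fun u => (walk p₀ p₁ η u n, u n))
      = (uniforms.map fun u => walk p₀ p₁ η u n).prod (volume.restrict (Icc (0 : ℝ) 1)) := by
  rw [(indepFun_iff_map_prod_eq_prod_map_map (measurable_walk_right η n).aemeasurable
    (measurable_pi_apply n).aemeasurable).1 (indepFun_walk η n), uniforms,
    (measurePreserving_eval_infinitePi _ n).map_eq]

lemma integral_ite_le {q : ℝ} (hq : q ∈ Icc (0 : ℝ) 1) (a b : ℝ) :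
    ∫ r in Icc (0 : ℝ) 1, (if r ≤ q then a else b) = q * a + (1 - q) * b := by
  have hmass : (volume.restrict (Icc (0 : ℝ) 1)).real (Iic q) = q := by
    have hinter : Iic q ∩ Icc (0 : ℝ) 1 = Icc 0 q := by
      ext r
      simp only [mem_inter_iff, mem_Iic, mem_Icc]
      exact ⟨fun h => ⟨h.2.1, h.1⟩, fun h => ⟨h.2, h.1, h.2.trans hq.2⟩⟩
    rw [measureReal_restrict_apply measurableSet_Iic, hinter,
      Real.volume_real_Icc_of_le hq.1, sub_zero]
  have hindicator : (fun r : ℝ => if r ≤ q then a else b)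
      = fun r => (Iic q).indicator (fun _ => a - b) r + b := by
    funext r
    by_cases hr : r ≤ q <;> simp [hr]
  rw [hindicator, integral_add ((integrable_const _).indicator measurableSet_Iic)
    (integrable_const _), integral_indicator_const _ measurableSet_Iic, hmass, integral_const,
    probReal_univ]
  simp only [smul_eq_mul]
  ring

lemma integral_walk_succ (hp : JumpRates p₀ p₁) (η : EnvPath T) (n : ℕ) {Φ : ℤ → ℝ} {a b : ℝ}
    (hΦ : ∀ x, Φ x ∈ Icc a b) :
    ∫ u, Φ (walk p₀ p₁ η u (n + 1)) ∂uniforms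
      = ∫ u, jump p₀ p₁ (η n) Φ (walk p₀ p₁ η u n) ∂uniforms := by
  let step : ℤ × ℝ → ℝ := fun z =>
    if z.2 ≤ jumpProb p₀ p₁ (η (n : T) z.1) then Φ (z.1 + 1) else Φ (z.1 - 1)
  have hstep : Measurable step := measurable_from_prod_countable_right fun x => by
    simp only [step]
    exact .ite measurableSet_Iic measurable_const measurable_const
  have hstep_mem : ∀ z, step z ∈ Icc a b := fun z => by
    simp only [step]; split_ifs <;> apply hΦ
  have hwalk : Measurable fun u : ℕ → ℝ => walk p₀ p₁ η u n := measurable_walk_right η n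
  have : IsProbabilityMeasure (uniforms.map fun u => walk p₀ p₁ η u n) :=
    Measure.isProbabilityMeasure_map hwalk.aemeasurable
  calc ∫ u, Φ (walk p₀ p₁ η u (n + 1)) ∂uniforms
      = ∫ u, step (walk p₀ p₁ η u n, u n) ∂uniforms := by
        simp only [step, walk_succ, apply_ite Φ]
    _ = ∫ z, step z ∂(uniforms.map fun u => (walk p₀ p₁ η u n, u n)) :=
        (integral_map (hwalk.prodMk (measurable_pi_apply n)).aemeasurable
          hstep.aestronglyMeasurable).symm
    _ = ∫ x, (∫ r in Icc (0 : ℝ) 1, step (x, r)) ∂(uniforms.map fun u => walk p₀ p₁ η u n) := by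
        rw [map_walk_prodMk_uniforms, integral_prod]
        exact .of_mem_Icc a b hstep.aemeasurable (ae_of_all _ hstep_mem)
    _ = ∫ x, jump p₀ p₁ (η n) Φ x ∂(uniforms.map fun u => walk p₀ p₁ η u n) :=
        integral_congr_ae (ae_of_all _ fun x =>
          integral_ite_le (jumpProb_mem_Icc hp (η n x)) (Φ (x + 1)) (Φ (x - 1)))
    _ = ∫ u, jump p₀ p₁ (η n) Φ (walk p₀ p₁ η u n) ∂uniforms :=
        integral_map hwalk.aemeasurable (measurable_of_countable _).aestronglyMeasurable

lemma integral_walk_uniforms (hp : JumpRates p₀ p₁) (η : EnvPath T) (n : ℕ) {Φ : ℤ → ℝ}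
    {a b : ℝ} (hΦ : ∀ x, Φ x ∈ Icc a b) :
    ∫ u, Φ (walk p₀ p₁ η u n) ∂uniforms = quenched p₀ p₁ η n Φ 0 := by
  induction n generalizing Φ with
  | zero => simp [walk, quenched]
  | succ n ih =>
    rw [integral_walk_succ hp η n hΦ, quenched, ih (jump_mem hp _ (convex_Icc a b) hΦ)]

end Walk

/-! ### The Markov property -/

section Stopped

variable {T : Type} [LinearOrder T]

/-- The trajectory `η` frozen from time `s` on, which encodes its past up to time `s`. -/
def stopped (s : T) (η : EnvPath T) : EnvPath T := fun t => η (min t s)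

lemma stopped_self (s : T) (η : EnvPath T) : stopped s η s = η s := by
  rw [stopped, min_self]

lemma past_le (s : T) : past s ≤ (inferInstance : MeasurableSpace (EnvPath T)) :=
  iSup_le fun u => (measurable_pi_apply (u : T)).comap_le

lemma measurable_past_stopped (s : T) : Measurable[past s] (stopped s) := by
  refine @measurable_pi_lambda _ _ _ (past s) _ _ fun t B hB => ?_
  exact le_iSup (fun u : {u : T // u ≤ s} =>
    MeasurableSpace.comap (fun η : EnvPath T => η u) inferInstance) ⟨_, min_le_right t s⟩ _
    ⟨B, hB, rfl⟩

lemma measurable_stopped (s : T) : Measurable (stopped s) :=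
  (measurable_past_stopped s).mono (past_le s) le_rfl

lemma quenched_stopped [CommSemiring T] [IsStrictOrderedRing T] {p₀ p₁ : ℝ} (η : EnvPath T) (n : ℕ)
    (Φ : ℤ → ℝ) : quenched p₀ p₁ (stopped (n : T) η) n Φ = quenched p₀ p₁ η n Φ :=
  quenched_congr_env (fun j hj => by rw [stopped, min_eq_left (Nat.cast_le.2 hj.le)]) Φ

end Stopped

namespace Environment

variable {T : Type} [CommSemiring T] [LinearOrder T] (E : Environment T)

instance : IsMarkovKernel E.P := E.isMarkovKernel_P

lemma measurable_integral_P {f : EnvPath T → ℝ} (hf : Measurable f) :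
    Measurable fun ζ => ∫ η, f η ∂(E.P ζ) :=
  (hf.stronglyMeasurable.integral_kernel (κ := E.P)).measurable

lemma map_stopped_prodMk_shift (η₀ : Config) (s : T) :
    (E.P η₀).map (fun η => (stopped s η, shift s 0 η))
      = (E.P η₀).map (stopped s) ⊗ₘ E.P.comap (fun η : EnvPath T => η s)
          (measurable_pi_apply s) := by
  have hpair : Measurable fun η : EnvPath T => (stopped s η, shift s 0 η) :=
    (measurable_stopped s).prodMk (measurable_shift s 0)
  have := Measure.isProbabilityMeasure_map (μ := E.P η₀) hpair.aemeasurable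
  have := Measure.isProbabilityMeasure_map (μ := E.P η₀) (measurable_stopped s).aemeasurable
  refine Measure.ext_prod fun {A B} hA hB => ?_
  have htranslate : ∀ ζ, translate 0 ζ = ζ := fun ζ => funext fun y => by rw [translate, zero_add]
  rw [Measure.map_apply hpair (hA.prod hB), mk_preimage_prod,
    E.markov η₀ s 0 _ B (measurable_past_stopped s hA) hB, Measure.compProd_apply_prod hA hB,
    setLIntegral_map hA (Kernel.measurable_coe _ hB) (measurable_stopped s)]
  simp only [Kernel.comap_apply, stopped_self, htranslate]

lemma integral_stopped_shift (η₀ : Config) (s : T) {F : EnvPath T × EnvPath T → ℝ}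
    (hF : Measurable F) {a b : ℝ} (hab : ∀ z, F z ∈ Icc a b) :
    ∫ η, F (stopped s η, shift s 0 η) ∂(E.P η₀)
      = ∫ η, ∫ η', F (stopped s η, η') ∂(E.P (η s)) ∂(E.P η₀) := by
  have hpair : Measurable fun η : EnvPath T => (stopped s η, shift s 0 η) :=
    (measurable_stopped s).prodMk (measurable_shift s 0)
  have := Measure.isProbabilityMeasure_map (μ := E.P η₀) (measurable_stopped s).aemeasurable
  let κ := E.P.comap (fun η : EnvPath T => η s) (measurable_pi_apply s)
  calc ∫ η, F (stopped s η, shift s 0 η) ∂(E.P η₀)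
      = ∫ z, F z ∂((E.P η₀).map (stopped s) ⊗ₘ κ) := by
        rw [← map_stopped_prodMk_shift, integral_map hpair.aemeasurable hF.aestronglyMeasurable]
    _ = ∫ η, ∫ η', F (η, η') ∂(κ η) ∂((E.P η₀).map (stopped s)) :=
        Measure.integral_compProd (.of_mem_Icc a b hF.aemeasurable (ae_of_all _ hab))
    _ = ∫ η, ∫ η', F (stopped s η, η') ∂(κ (stopped s η)) ∂(E.P η₀) :=
        integral_map (measurable_stopped s).aemeasurable
          (hF.stronglyMeasurable.integral_kernel_prod_right' (κ := κ)).aestronglyMeasurable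
    _ = ∫ η, ∫ η', F (stopped s η, η') ∂(E.P (η s)) ∂(E.P η₀) := by
        simp only [κ, Kernel.comap_apply, stopped_self]

/-! ### Annealed laws -/

/-- The annealed law of the environment, `𝐏^ρ` in the paper. -/
def envLaw (ρ : ℝ) : Measure (EnvPath T) := (E.μ ρ).bind E.P

/-- The annealed law of the position of the walk at time `n`. -/
def walkLaw (p₀ p₁ ρ : ℝ) (n : ℕ) : Measure ℤ :=
  (E.annealed ρ).map fun ω => walk p₀ p₁ ω.1 ω.2 n

variable {p₀ p₁ ρ : ℝ}

lemma isProbabilityMeasure_envLaw (hρ : ρ ∈ E.J) : IsProbabilityMeasure (E.envLaw ρ) := by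
  have := E.isProbabilityMeasure_μ ρ hρ
  unfold envLaw; infer_instance

lemma isProbabilityMeasure_annealed (hρ : ρ ∈ E.J) : IsProbabilityMeasure (E.annealed ρ) := by
  have := E.isProbabilityMeasure_envLaw hρ
  exact inferInstanceAs (IsProbabilityMeasure ((E.envLaw ρ).prod uniforms))

lemma isProbabilityMeasure_walkLaw (hρ : ρ ∈ E.J) (n : ℕ) :
    IsProbabilityMeasure (E.walkLaw p₀ p₁ ρ n) := by
  have := E.isProbabilityMeasure_annealed hρ
  exact Measure.isProbabilityMeasure_map (measurable_walk n).aemeasurable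

lemma integral_envLaw (hρ : ρ ∈ E.J) {f : EnvPath T → ℝ} (hf : Measurable f) {a b : ℝ}
    (hab : ∀ η, f η ∈ Icc a b) :
    ∫ η, f η ∂(E.envLaw ρ) = ∫ ζ, ∫ η, f η ∂(E.P ζ) ∂(E.μ ρ) := by
  have := E.isProbabilityMeasure_envLaw hρ
  have hcomp : E.envLaw ρ = (E.P ∘ₖ Kernel.const Unit (E.μ ρ)) () := by
    rw [Kernel.comp_apply, Kernel.const_apply]; rfl
  have hint : Integrable f (E.envLaw ρ) := .of_mem_Icc a b hf.aemeasurable (ae_of_all _ hab)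
  rw [hcomp] at hint ⊢
  rw [Kernel.integral_comp hint, Kernel.const_apply]

lemma map_shift_zero_envLaw (hρ : ρ ∈ E.J) (x : ℤ) :
    (E.envLaw ρ).map (shift 0 x) = E.envLaw ρ := by
  ext B hB
  have hP : ∀ ζ, E.P ζ (shift 0 x ⁻¹' B) = E.P (translate x ζ) B := fun ζ => by
    have hmarkov := E.markov ζ 0 x univ B .univ hB
    rw [univ_inter, Measure.restrict_univ] at hmarkov
    have hstart : ∀ᵐ η ∂(E.P ζ), E.P (translate x (η 0)) B = E.P (translate x ζ) B :=
      (E.start ζ).mono fun η hη => by rw [hη]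
    rw [hmarkov, lintegral_congr_ae hstart, lintegral_const, measure_univ, mul_one]
  rw [Measure.map_apply (measurable_shift 0 x) hB, envLaw,
    Measure.bind_apply (measurable_shift 0 x hB) E.P.aemeasurable,
    Measure.bind_apply hB E.P.aemeasurable]
  simp_rw [hP]
  rw [← lintegral_map (E.P.measurable_coe hB) (measurable_translate x), E.map_translate_μ ρ hρ x]

lemma map_eval_zero_P (ζ : Config) : (E.P ζ).map (fun η => η 0) = Measure.dirac ζ := by
  rw [Measure.map_congr (E.start ζ), Measure.map_const, measure_univ, one_smul]

lemma map_eval_envLaw (hρ : ρ ∈ E.J) (s : T) : (E.envLaw ρ).map (fun η => η s) = E.μ ρ := by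
  have heval : (fun η : EnvPath T => η s) = (fun η => η 0) ∘ shift s 0 := by
    funext η y
    simp only [Function.comp_apply, shift, translate, add_zero, zero_add]
  have hstationary : (E.envLaw ρ).map (shift s 0) = E.envLaw ρ := E.stationary ρ hρ s
  ext B hB
  rw [heval, ← Measure.map_map (measurable_pi_apply 0) (measurable_shift s 0), hstationary,
    Measure.map_apply (measurable_pi_apply 0) hB, envLaw,
    Measure.bind_apply (measurable_pi_apply (0 : T) hB) E.P.aemeasurable,
    ← lintegral_indicator_one hB]
  refine lintegral_congr fun ζ => ?_
  rw [← Measure.map_apply (measurable_pi_apply 0) hB, map_eval_zero_P, Measure.dirac_apply' _ hB]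

lemma ae_walkLaw_abs_le (ρ : ℝ) (n : ℕ) : ∀ᵐ x ∂(E.walkLaw p₀ p₁ ρ n), |x| ≤ (n : ℤ) := by
  rw [walkLaw, ae_map_iff (measurable_walk n).aemeasurable .of_discrete]
  exact ae_of_all _ fun ω => abs_walk_le _ _ n

lemma integral_walkLaw (hp : JumpRates p₀ p₁) (hρ : ρ ∈ E.J) (n : ℕ) {Φ : ℤ → ℝ} {a b : ℝ}
    (hΦ : ∀ x, Φ x ∈ Icc a b) :
    ∫ x, Φ x ∂(E.walkLaw p₀ p₁ ρ n) = ∫ η, quenched p₀ p₁ η n Φ 0 ∂(E.envLaw ρ) := by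
  have := E.isProbabilityMeasure_envLaw hρ
  have hΦm : Measurable Φ := measurable_of_countable _
  have hint : Integrable (fun ω : EnvPath T × (ℕ → ℝ) => Φ (walk p₀ p₁ ω.1 ω.2 n))
      ((E.envLaw ρ).prod uniforms) :=
    .of_mem_Icc a b (hΦm.comp (measurable_walk n)).aemeasurable (ae_of_all _ fun _ => hΦ _)
  calc ∫ x, Φ x ∂(E.walkLaw p₀ p₁ ρ n)
      = ∫ ω, Φ (walk p₀ p₁ ω.1 ω.2 n) ∂((E.envLaw ρ).prod uniforms) :=
        integral_map (measurable_walk n).aemeasurable hΦm.aestronglyMeasurable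
    _ = ∫ η, ∫ u, Φ (walk p₀ p₁ η u n) ∂uniforms ∂(E.envLaw ρ) := integral_prod _ hint
    _ = ∫ η, quenched p₀ p₁ η n Φ 0 ∂(E.envLaw ρ) := by
        simp only [integral_walk_uniforms hp _ n hΦ]

lemma meanSpeed_eq (ρ : ℝ) (L : ℕ) :
    E.meanSpeed p₀ p₁ ρ L = (∫ x, (x : ℝ) ∂(E.walkLaw p₀ p₁ ρ L)) / L := by
  rw [walkLaw, integral_map (measurable_walk L).aemeasurable
    (measurable_of_countable _).aestronglyMeasurable, meanSpeed, integral_div]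

/-! ### The transition operators of the walk and its environment -/

/-- The transition operators of the Markov process formed by the walk and its environment:
`E.transition p₀ p₁ n Φ x ζ` is the expectation of `Φ (X n)` for the walk started from `x` in the
environment started from `ζ`. -/
def transition (p₀ p₁ : ℝ) (n : ℕ) (Φ : ℤ → ℝ) (x : ℤ) (ζ : Config) : ℝ :=
  ∫ η, quenched p₀ p₁ η n Φ x ∂(E.P ζ)

/-- The expectation of `Φ (X (t + n))` for a walk which stays at `x` up to time `t`, in the
environment started from `ζ`. -/
def delayed (p₀ p₁ : ℝ) (t n : ℕ) (Φ : ℤ → ℝ) (x : ℤ) (ζ : Config) : ℝ :=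
  ∫ η, E.transition p₀ p₁ n Φ x (η (t : T)) ∂(E.P ζ)

lemma measurable_transition (n : ℕ) (Φ : ℤ → ℝ) (x : ℤ) :
    Measurable (E.transition p₀ p₁ n Φ x) :=
  E.measurable_integral_P (measurable_quenched n Φ x)

lemma measurable_delayed (t n : ℕ) (Φ : ℤ → ℝ) (x : ℤ) :
    Measurable (E.delayed p₀ p₁ t n Φ x) :=
  E.measurable_integral_P ((E.measurable_transition n Φ x).comp (measurable_pi_apply _))

section Bounded

variable {Φ : ℤ → ℝ} {a b : ℝ}

lemma transition_mem_Icc (hp : JumpRates p₀ p₁) (n : ℕ) (hΦ : ∀ x, Φ x ∈ Icc a b) (x : ℤ)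
    (ζ : Config) : E.transition p₀ p₁ n Φ x ζ ∈ Icc a b :=
  (convex_Icc a b).integral_mem isClosed_Icc
    (ae_of_all _ fun η => quenched_mem hp η n (convex_Icc a b) hΦ x) (integrable_quenched hp n hΦ x)

lemma integrable_transition_eval (hp : JumpRates p₀ p₁) (n : ℕ) (hΦ : ∀ x, Φ x ∈ Icc a b) (x : ℤ)
    (s : T) (m : Measure (EnvPath T)) [IsFiniteMeasure m] :
    Integrable (fun η => E.transition p₀ p₁ n Φ x (η s)) m :=
  .of_mem_Icc a b ((E.measurable_transition n Φ x).comp (measurable_pi_apply s)).aemeasurable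
    (ae_of_all _ fun _ => E.transition_mem_Icc hp n hΦ x _)

lemma delayed_mem_Icc (hp : JumpRates p₀ p₁) (t n : ℕ) (hΦ : ∀ x, Φ x ∈ Icc a b) (x : ℤ)
    (ζ : Config) : E.delayed p₀ p₁ t n Φ x ζ ∈ Icc a b :=
  (convex_Icc a b).integral_mem isClosed_Icc (ae_of_all _ fun _ => E.transition_mem_Icc hp n hΦ x _)
    (E.integrable_transition_eval hp n hΦ x _ _)

lemma measurable_quenched_transition (n m : ℕ) (Φ : ℤ → ℝ) (x : ℤ) :
    Measurable fun η : EnvPath T =>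
      quenched p₀ p₁ η n (fun y => E.transition p₀ p₁ m Φ y (η n)) x :=
  measurable_quenched_comp (f := fun η => η) measurable_id n
    (fun y => (E.measurable_transition m Φ y).comp (measurable_pi_apply _)) x

lemma transition_add [IsStrictOrderedRing T] (hp : JumpRates p₀ p₁) (n m : ℕ)
    (hΦ : ∀ x, Φ x ∈ Icc a b) (x : ℤ) (ζ : Config) :
    E.transition p₀ p₁ (n + m) Φ x ζ
      = ∫ η, quenched p₀ p₁ η n (fun y => E.transition p₀ p₁ m Φ y (η n)) x ∂(E.P ζ) := by
  let F : EnvPath T × EnvPath T → ℝ := fun z =>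
    quenched p₀ p₁ z.1 n (quenched p₀ p₁ z.2 m Φ) x
  have hF : Measurable F := measurable_quenched_comp measurable_fst n
    (fun y => (measurable_quenched m Φ y).comp measurable_snd) x
  have hF_mem : ∀ z, F z ∈ Icc a b := fun z =>
    quenched_mem hp _ n (convex_Icc a b) (quenched_mem hp _ m (convex_Icc a b) hΦ) x
  calc E.transition p₀ p₁ (n + m) Φ x ζ
      = ∫ η, F (stopped (n : T) η, shift (n : T) 0 η) ∂(E.P ζ) := by
        simp only [F, transition, quenched_stopped, quenched_add]
    _ = ∫ η, ∫ η', F (stopped (n : T) η, η') ∂(E.P (η n)) ∂(E.P ζ) :=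
        E.integral_stopped_shift ζ _ hF hF_mem
    _ = ∫ η, quenched p₀ p₁ η n (fun y => E.transition p₀ p₁ m Φ y (η n)) x ∂(E.P ζ) := by
        simp only [F, quenched_stopped, transition]
        exact integral_congr_ae (ae_of_all _ fun η =>
          integral_quenched η n (fun y => integrable_quenched hp m hΦ y) x)

lemma integral_transition (hp : JumpRates p₀ p₁) (hρ : ρ ∈ E.J) (n : ℕ) (hΦ : ∀ x, Φ x ∈ Icc a b)
    (x : ℤ) :
    ∫ ζ, E.transition p₀ p₁ n Φ x ζ ∂(E.μ ρ) = ∫ y, Φ (x + y) ∂(E.walkLaw p₀ p₁ ρ n) := by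
  have hq : Measurable fun η : EnvPath T => quenched p₀ p₁ η n (fun z => Φ (x + z)) 0 :=
    measurable_quenched n _ 0
  calc ∫ ζ, E.transition p₀ p₁ n Φ x ζ ∂(E.μ ρ)
      = ∫ η, quenched p₀ p₁ η n Φ x ∂(E.envLaw ρ) :=
        (E.integral_envLaw hρ (measurable_quenched n Φ x)
          fun η => quenched_mem hp η n (convex_Icc a b) hΦ x).symm
    _ = ∫ η, quenched p₀ p₁ (shift 0 x η) n (fun z => Φ (x + z)) 0 ∂(E.envLaw ρ) := by
        simp only [quenched_shift_zero, add_zero]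
    _ = ∫ η, quenched p₀ p₁ η n (fun z => Φ (x + z)) 0 ∂(E.envLaw ρ) := by
        rw [← integral_map (measurable_shift 0 x).aemeasurable hq.aestronglyMeasurable,
          E.map_shift_zero_envLaw hρ]
    _ = ∫ y, Φ (x + y) ∂(E.walkLaw p₀ p₁ ρ n) :=
        (E.integral_walkLaw hp hρ n fun y => hΦ (x + y)).symm

lemma integral_delayed (hp : JumpRates p₀ p₁) (hρ : ρ ∈ E.J) (t n : ℕ)
    (hΦ : ∀ x, Φ x ∈ Icc a b) (x : ℤ) :
    ∫ ζ, E.delayed p₀ p₁ t n Φ x ζ ∂(E.μ ρ) = ∫ y, Φ (x + y) ∂(E.walkLaw p₀ p₁ ρ n) := by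
  have htr := E.measurable_transition (p₀ := p₀) (p₁ := p₁) n Φ x
  calc ∫ ζ, E.delayed p₀ p₁ t n Φ x ζ ∂(E.μ ρ)
      = ∫ η, E.transition p₀ p₁ n Φ x (η (t : T)) ∂(E.envLaw ρ) :=
        (E.integral_envLaw hρ (htr.comp (measurable_pi_apply _))
          fun η => E.transition_mem_Icc hp n hΦ x _).symm
    _ = ∫ ζ, E.transition p₀ p₁ n Φ x ζ ∂(E.μ ρ) := by
        rw [← E.map_eval_envLaw hρ (t : T),
          integral_map (measurable_pi_apply _).aemeasurable htr.aestronglyMeasurable]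
    _ = ∫ y, Φ (x + y) ∂(E.walkLaw p₀ p₁ ρ n) := E.integral_transition hp hρ n hΦ x

lemma integral_walkLaw_add [IsStrictOrderedRing T] (hp : JumpRates p₀ p₁) (hρ : ρ ∈ E.J)
    (n m : ℕ) (hΦ : ∀ x, Φ x ∈ Icc a b) :
    ∫ x, Φ x ∂(E.walkLaw p₀ p₁ ρ (n + m))
      = ∫ η, quenched p₀ p₁ η n (fun y => E.transition p₀ p₁ m Φ y (η n)) 0 ∂(E.envLaw ρ) := by
  have hlaw := E.integral_transition hp hρ (n + m) hΦ 0
  simp only [zero_add] at hlaw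
  rw [← hlaw, E.integral_envLaw hρ (E.measurable_quenched_transition n m Φ 0) fun η =>
    quenched_mem hp η n (convex_Icc a b) (fun y => E.transition_mem_Icc hp m hΦ y _) 0]
  simp only [E.transition_add hp n m hΦ]

end Bounded

lemma transition_neg (n : ℕ) (Φ : ℤ → ℝ) (x : ℤ) (ζ : Config) :
    E.transition p₀ p₁ n (fun y => -Φ y) x ζ = -E.transition p₀ p₁ n Φ x ζ := by
  simp only [transition, quenched_neg, integral_neg]

lemma parityMono_transition (hp : JumpRates p₀ p₁) (n : ℕ) {Φ : ℤ → ℝ} {a b : ℝ}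
    (hΦ : ∀ x, Φ x ∈ Icc a b) (hmono : ParityMono Φ) (ζ : Config) :
    ParityMono fun x => E.transition p₀ p₁ n Φ x ζ := fun x =>
  integral_mono (integrable_quenched hp n hΦ x) (integrable_quenched hp n hΦ (x + 2))
    fun η => hmono.quenched hp η n x

lemma transition_add_mem_Icc [IsStrictOrderedRing T] (hp : JumpRates p₀ p₁) (t n : ℕ) {Φ : ℤ → ℝ}
    {a b : ℝ} (hΦ : ∀ x, Φ x ∈ Icc a b) (hmono : ParityMono Φ) (x : ℤ) (ζ : Config) :
    E.transition p₀ p₁ (t + n) Φ x ζ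
      ∈ Icc (E.delayed p₀ p₁ t n Φ (x - t) ζ) (E.delayed p₀ p₁ t n Φ (x + t) ζ) := by
  have hstep : ∀ η : EnvPath T,
      quenched p₀ p₁ η t (fun y => E.transition p₀ p₁ n Φ y (η (t : T))) x
        ∈ Icc (E.transition p₀ p₁ n Φ (x - t) (η t)) (E.transition p₀ p₁ n Φ (x + t) (η t)) :=
    fun η => (E.parityMono_transition hp n hΦ hmono (η t)).quenched_mem_Icc hp η t x
  have hint : Integrable
      (fun η : EnvPath T => quenched p₀ p₁ η t (fun y => E.transition p₀ p₁ n Φ y (η t)) x)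
      (E.P ζ) :=
    .of_mem_Icc a b (E.measurable_quenched_transition t n Φ x).aemeasurable
      (ae_of_all _ fun η => quenched_mem hp η t (convex_Icc a b)
        (fun y => E.transition_mem_Icc hp n hΦ y _) x)
  rw [E.transition_add hp t n hΦ]
  exact ⟨integral_mono (E.integrable_transition_eval hp n hΦ _ _ _) hint fun η => (hstep η).1,
    integral_mono hint (E.integrable_transition_eval hp n hΦ _ _ _) fun η => (hstep η).2⟩

end Environment

/-! ### Comparison of integrals through a coupling -/

lemma integral_le_add_measureReal {α : Type*} [MeasurableSpace α] {m : Measure α}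
    [IsProbabilityMeasure m] {f g : α → ℝ} (hf : Integrable f m) (hg : Integrable g m) {S : Set α}
    (hS : MeasurableSet S) {d M : ℝ} (hd : 0 ≤ d) (hfg : ∀ x ∉ S, f x ≤ g x + d)
    (hM : ∀ x, f x ≤ g x + M) :
    ∫ x, f x ∂m ≤ ∫ x, g x ∂m + d + M * m.real S := by
  have hind : Integrable (S.indicator fun _ => M) m := (integrable_const M).indicator hS
  have hgd : Integrable (fun x => g x + d) m := hg.add (integrable_const d)
  have hpt : ∀ x, f x ≤ g x + d + S.indicator (fun _ => M) x := fun x => by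
    by_cases hx : x ∈ S
    · rw [indicator_of_mem hx]
      linarith [hM x]
    · rw [indicator_of_notMem hx, add_zero]
      exact hfg x hx
  calc ∫ x, f x ∂m ≤ ∫ x, (g x + d + S.indicator (fun _ => M) x) ∂m :=
        integral_mono hf (hgd.add hind) hpt
    _ = ∫ x, g x ∂m + d + M * m.real S := by
        rw [integral_add hgd hind, integral_add hg (integrable_const d),
          integral_indicator_const _ hS]
        simp [mul_comm]

lemma IsCoupling.isProbabilityMeasure {A B : Type} [MeasurableSpace A] [MeasurableSpace B]
    {m₁ : Measure A} {m₂ : Measure B} [IsProbabilityMeasure m₁] {Q : Measure (A × B)}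
    (hQ : IsCoupling Q m₁ m₂) : IsProbabilityMeasure Q := by
  rw [← Measure.isProbabilityMeasure_map_iff measurable_fst.aemeasurable, hQ.1]
  infer_instance

lemma IsCoupling.integral_le {A B : Type} [MeasurableSpace A] [MeasurableSpace B]
    {m₁ : Measure A} {m₂ : Measure B} [IsProbabilityMeasure m₁] {Q : Measure (A × B)}
    (hQ : IsCoupling Q m₁ m₂) {f : A → ℝ} {g : B → ℝ} (hf : Measurable f) (hg : Measurable g)
    {a b : ℝ} (hfab : ∀ x, f x ∈ Icc a b) (hgab : ∀ y, g y ∈ Icc a b) {d e : ℝ} (hd : 0 ≤ d)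
    {S : Set (A × B)} (hS : 1 - e ≤ Q.real S) (h : ∀ ω ∈ S, g ω.2 ≤ f ω.1 + d) :
    ∫ y, g y ∂m₂ ≤ ∫ x, f x ∂m₁ + d + (b - a) * e := by
  have hQprob := hQ.isProbabilityMeasure
  obtain ⟨x₀⟩ := nonempty_of_isProbabilityMeasure m₁
  have hab : 0 ≤ b - a := sub_nonneg.2 ((hfab x₀).1.trans (hfab x₀).2)
  -- `S` need not be measurable, but it is contained in a measurable set with the same property
  have hgood : MeasurableSet {ω : A × B | g ω.2 ≤ f ω.1 + d} :=
    measurableSet_le (hg.comp measurable_snd) ((hf.comp measurable_fst).add_const d)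
  have hbad : Q.real {ω : A × B | g ω.2 ≤ f ω.1 + d}ᶜ ≤ e := by
    have hS' : Q.real S ≤ Q.real {ω : A × B | g ω.2 ≤ f ω.1 + d} := measureReal_mono h
    rw [probReal_compl_eq_one_sub hgood]
    linarith
  rw [← hQ.1, ← hQ.2, integral_map measurable_snd.aemeasurable hg.aestronglyMeasurable,
    integral_map measurable_fst.aemeasurable hf.aestronglyMeasurable]
  calc ∫ ω, g ω.2 ∂Q
      ≤ ∫ ω, f ω.1 ∂Q + d + (b - a) * Q.real {ω : A × B | g ω.2 ≤ f ω.1 + d}ᶜ :=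
        integral_le_add_measureReal (f := fun ω => g ω.2) (g := fun ω => f ω.1)
          (.of_mem_Icc a b (hg.comp measurable_snd).aemeasurable (ae_of_all _ fun _ => hgab _))
          (.of_mem_Icc a b (hf.comp measurable_fst).aemeasurable (ae_of_all _ fun _ => hfab _))
          hgood.compl hd (fun ω hω => by simpa using hω)
          fun ω => by linarith [(hgab ω.2).2, (hfab ω.1).1]
    _ ≤ ∫ ω, f ω.1 ∂Q + d + (b - a) * e := by gcongr

/-! ### Configurations with an atypical empirical density -/

/-- The configurations whose empirical density on `[a, a + m - 1]` differs from `ρ` by at least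
`δ`. -/
def atypical (ρ δ : ℝ) (a : ℤ) (m : ℕ) : Set Config :=
  {ζ | δ * m ≤ |(count ζ a (a + m - 1) : ℝ) - ρ * m|}

/-- The configurations whose empirical density differs from `ρ` by at least `δ` on some interval
of length between `ℓ / 2` and `ℓ` which starts in `[-H, H]`. -/
def irregular (ρ δ : ℝ) (H ℓ : ℕ) : Set Config :=
  ⋃ a ∈ Finset.Icc (-(H : ℤ)) H, ⋃ m ∈ Finset.Icc (max 1 (ℓ / 2)) ℓ, atypical ρ δ a m

lemma measurableSet_atypical (ρ δ : ℝ) (a : ℤ) (m : ℕ) : MeasurableSet (atypical ρ δ a m) :=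
  measurableSet_le measurable_const (((measurable_from_nat.comp
    (measurable_count a (a + m - 1))).sub_const (ρ * m)).abs)

lemma measurableSet_irregular (ρ δ : ℝ) (H ℓ : ℕ) : MeasurableSet (irregular ρ δ H ℓ) :=
  Finset.measurableSet_biUnion _ fun a _ => Finset.measurableSet_biUnion _ fun m _ =>
    measurableSet_atypical ρ δ a m

lemma abs_count_sub_lt {ρ δ : ℝ} {H ℓ : ℕ} {ζ : Config} (h : ζ ∉ irregular ρ δ H ℓ) {a b : ℤ}
    (ha : -(H : ℤ) ≤ a) (hab : a ≤ b) (hb : b ≤ H) (hℓ : (ℓ : ℤ) / 2 ≤ b - a + 1)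
    (hℓ' : b - a + 1 ≤ ℓ) :
    |(count ζ a b : ℝ) - ρ * ((b - a + 1 : ℤ) : ℝ)| < δ * ((b - a + 1 : ℤ) : ℝ) := by
  obtain ⟨m, hm⟩ := Int.eq_ofNat_of_zero_le (show 0 ≤ b - a + 1 by omega)
  obtain rfl : b = a + m - 1 := by omega
  have hζ : ζ ∉ atypical ρ δ a m := fun hmem => h <| by
    simp only [irregular, mem_iUnion, Finset.mem_Icc]
    exact ⟨a, ⟨ha, by omega⟩, m, by omega, hmem⟩
  rw [hm]
  simpa [atypical] using hζ

lemma count_translate (a b c : ℤ) (ζ : Config) :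
    count (translate a ζ) b c = count ζ (a + b) (a + c) := by
  unfold count translate
  rw [← Finset.image_add_left_Icc, Finset.sum_image fun _ _ _ _ => add_left_cancel]

namespace Environment

variable {T : Type} [CommSemiring T] [LinearOrder T] (E : Environment T) {ρ : ℝ}

lemma measureReal_atypical (hρ : ρ ∈ E.J) (δ : ℝ) (a : ℤ) (m : ℕ) :
    (E.μ ρ).real (atypical ρ δ a m) = (E.μ ρ).real (atypical ρ δ 0 m) := by
  have hpre : translate a ⁻¹' atypical ρ δ 0 m = atypical ρ δ a m := by
    simp only [atypical, preimage_ofPred_eq, count_translate, add_zero, zero_add, add_sub_assoc]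
  rw [← hpre, ← map_measureReal_apply (measurable_translate a) (measurableSet_atypical ρ δ 0 m),
    E.map_translate_μ ρ hρ a]

lemma measureReal_irregular_le {δ κ : ℝ} (hκ : 0 ≤ κ) (hρ : ρ ∈ E.J)
    (h : ∀ m : ℕ, 1 ≤ m → (E.μ ρ).real (atypical ρ δ 0 m) ≤ 2 * Real.exp (-κ * m)) (H ℓ : ℕ) :
    (E.μ ρ).real (irregular ρ δ H ℓ)
      ≤ (2 * H + 1) * (ℓ * (2 * Real.exp (-κ * ((ℓ - 1) / 2)))) := by
  have hatyp : ∀ a : ℤ, ∀ m ∈ Finset.Icc (max 1 (ℓ / 2)) ℓ,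
      (E.μ ρ).real (atypical ρ δ a m) ≤ 2 * Real.exp (-κ * ((ℓ - 1) / 2)) := by
    intro a m hm
    simp only [Finset.mem_Icc] at hm
    have hmℓ : ((ℓ : ℝ) - 1) / 2 ≤ m := by
      have : (ℓ : ℝ) ≤ 2 * m + 1 := by exact_mod_cast (by omega : ℓ ≤ 2 * m + 1)
      linarith
    rw [E.measureReal_atypical hρ]
    refine (h m (by omega)).trans ?_
    gcongr 2 * Real.exp ?_
    nlinarith
  have hlengths : ((Finset.Icc (max 1 (ℓ / 2)) ℓ).card : ℝ) ≤ ℓ := by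
    rw [Nat.card_Icc]
    exact_mod_cast (by omega : ℓ + 1 - max 1 (ℓ / 2) ≤ ℓ)
  have hstarts : ((Finset.Icc (-(H : ℤ)) H).card : ℝ) = 2 * H + 1 := by
    rw [Int.card_Icc]
    exact_mod_cast (by omega : ((H : ℤ) + 1 - -(H : ℤ)).toNat = 2 * H + 1)
  calc (E.μ ρ).real (irregular ρ δ H ℓ)
      ≤ ∑ a ∈ Finset.Icc (-(H : ℤ)) H, ∑ m ∈ Finset.Icc (max 1 (ℓ / 2)) ℓ,
          (E.μ ρ).real (atypical ρ δ a m) :=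
        (measureReal_biUnion_finset_le _ _).trans
          (Finset.sum_le_sum fun a _ => measureReal_biUnion_finset_le _ _)
    _ ≤ ∑ _a ∈ Finset.Icc (-(H : ℤ)) H, ∑ _m ∈ Finset.Icc (max 1 (ℓ / 2)) ℓ,
          2 * Real.exp (-κ * ((ℓ - 1) / 2)) :=
        Finset.sum_le_sum fun a _ => Finset.sum_le_sum fun m hm => hatyp a m hm
    _ ≤ (2 * H + 1) * (ℓ * (2 * Real.exp (-κ * ((ℓ - 1) / 2)))) := by
        simp only [Finset.sum_const, nsmul_eq_mul, hstarts]
        gcongr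

/-! ### Comparison of the walk in two environments -/

variable {E} {p₀ p₁ ν a b ε : ℝ} {Φ : ℤ → ℝ}

lemma transition_le_of_noDriftingIn [IsStrictOrderedRing T] (hdrift : E.NoDriftingIn ν)
    (hp : JumpRates p₀ p₁) {L H : ℕ} {y : ℤ} (hH : |(y : ℝ)| + L + 2 * ν * L ≤ H) {ξ' ξ : Config}
    (h : ∀ x : ℤ, |x| ≤ (H : ℤ) → ξ' x ≤ ξ x) (hmono : ParityMono Φ) (hΦ : ∀ x, Φ x ∈ Icc a b) :
    E.transition p₀ p₁ L Φ y ξ'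
      ≤ E.transition p₀ p₁ L Φ y ξ + (b - a) * (20 * Real.exp (-(ν * L / 4))) := by
  obtain ⟨Q, hQ, hQS⟩ := hdrift L H 1 le_rfl ξ ξ' h
  have hmem : ∀ η : EnvPath T, quenched p₀ p₁ η L Φ y ∈ Icc a b :=
    fun η => quenched_mem hp η L (convex_Icc a b) hΦ y
  have hquenched : ∀ ω ∈ {ω : EnvPath T × EnvPath T | ∀ s : T, s ≤ (L : T) → ∀ x : ℤ,
      |(x : ℝ)| ≤ H - 2 * ν * (1 : ℕ) * L → ω.2 s x ≤ ω.1 s x},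
      quenched p₀ p₁ ω.2 L Φ y ≤ quenched p₀ p₁ ω.1 L Φ y + 0 := fun ω hω => by
    rw [add_zero]
    refine hmono.quenched_mono_env hp L fun j hj z hz => hω j (Nat.cast_le.2 hj.le) z ?_
    have hzy : |(z : ℝ) - y| ≤ L := by exact_mod_cast hz
    rw [Nat.cast_one]
    linarith [abs_sub_abs_le_abs_sub (z : ℝ) y]
  have hle := hQ.integral_le (measurable_quenched L Φ y) (measurable_quenched L Φ y) hmem hmem
    le_rfl hQS hquenched
  simpa [transition] using hle

/-- Up to probability `e`, a regular configuration of density `ρ + ε` can be made to dominate a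
regular configuration of density `ρ` at time `t`, away from the boundary of `[-H, H]`. -/
def Covers (E : Environment T) (ν ρ ε : ℝ) (H t ℓ : ℕ) (e : ℝ) : Prop :=
  ∀ ζ' ∉ irregular ρ (ε / 4) H ℓ, ∀ ζ ∉ irregular (ρ + ε) (ε / 4) H ℓ,
    ∃ Q : Measure (EnvPath T × EnvPath T), IsCoupling Q (E.P ζ) (E.P ζ') ∧
      1 - e ≤ Q.real {ω | ∀ x : ℤ, |(x : ℝ)| ≤ H - 4 * ν * t → ω.2 (t : T) x ≤ ω.1 (t : T) x}

lemma Covers.mono {H t ℓ : ℕ} {e e' : ℝ} (hcov : E.Covers ν ρ ε H t ℓ e) (h : e ≤ e') :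
    E.Covers ν ρ ε H t ℓ e' := fun ζ' hζ' ζ hζ =>
  let ⟨Q, hQ, hQe⟩ := hcov ζ' hζ' ζ hζ
  ⟨Q, hQ, (sub_le_sub_left h 1).trans hQe⟩

lemma Covers.delayed_le [IsStrictOrderedRing T] {H t ℓ : ℕ} {e : ℝ}
    (hcov : E.Covers ν ρ ε H t ℓ e) (hdrift : E.NoDriftingIn ν) (hp : JumpRates p₀ p₁) {L H' : ℕ}
    {y : ℤ} (hH' : |(y : ℝ)| + L + 2 * ν * L ≤ H') (hH : (H' : ℝ) ≤ H - 4 * ν * t)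
    {ζ' ζ : Config} (hζ' : ζ' ∉ irregular ρ (ε / 4) H ℓ)
    (hζ : ζ ∉ irregular (ρ + ε) (ε / 4) H ℓ) (hmono : ParityMono Φ) (hΦ : ∀ x, Φ x ∈ Icc a b) :
    E.delayed p₀ p₁ t L Φ y ζ'
      ≤ E.delayed p₀ p₁ t L Φ y ζ + (b - a) * (20 * Real.exp (-(ν * L / 4)) + e) := by
  have hab : 0 ≤ b - a := sub_nonneg.2 ((hΦ 0).1.trans (hΦ 0).2)
  obtain ⟨Q, hQ, hQe⟩ := hcov ζ' hζ' ζ hζ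
  have hmeas : Measurable fun η : EnvPath T => E.transition p₀ p₁ L Φ y (η t) :=
    (E.measurable_transition L Φ y).comp (measurable_pi_apply _)
  have hmem : ∀ η : EnvPath T, E.transition p₀ p₁ L Φ y (η t) ∈ Icc a b :=
    fun _ => E.transition_mem_Icc hp L hΦ y _
  have hle := hQ.integral_le hmeas hmeas hmem hmem (by positivity) hQe fun ω hω =>
    transition_le_of_noDriftingIn hdrift hp hH'
      (fun x hx => hω x (le_trans (by exact_mod_cast hx) hH)) hmono hΦ
  calc E.delayed p₀ p₁ t L Φ y ζ'
      ≤ E.delayed p₀ p₁ t L Φ y ζ + (b - a) * (20 * Real.exp (-(ν * L / 4))) + (b - a) * e := hle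
    _ = E.delayed p₀ p₁ t L Φ y ζ + (b - a) * (20 * Real.exp (-(ν * L / 4)) + e) := by ring

lemma integral_walkLaw_add_le [IsStrictOrderedRing T] (hp : JumpRates p₀ p₁) (hρ : ρ ∈ E.J)
    (n m : ℕ) (hΦ : ∀ x, Φ x ∈ Icc a b) {c : ℤ → ℝ} (hc : ∀ x, c x ∈ Icc a b) {e : ℝ}
    (he : 0 ≤ e) {S : Set Config} (hS : MeasurableSet S)
    (h : ∀ x : ℤ, |x| ≤ n → ∀ ζ ∉ S, E.transition p₀ p₁ m Φ x ζ ≤ c x + e) :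
    ∫ x, Φ x ∂(E.walkLaw p₀ p₁ ρ (n + m))
      ≤ ∫ x, c x ∂(E.walkLaw p₀ p₁ ρ n) + e + (b - a) * (E.μ ρ).real S := by
  have := E.isProbabilityMeasure_envLaw hρ
  have hmem : ∀ η : EnvPath T,
      quenched p₀ p₁ η n (fun y => E.transition p₀ p₁ m Φ y (η n)) 0 ∈ Icc a b :=
    fun η => quenched_mem hp η n (convex_Icc a b) (fun y => E.transition_mem_Icc hp m hΦ y _) 0
  have hmem_c : ∀ η : EnvPath T, quenched p₀ p₁ η n c 0 ∈ Icc a b :=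
    fun η => quenched_mem hp η n (convex_Icc a b) hc 0
  rw [E.integral_walkLaw_add hp hρ n m hΦ, E.integral_walkLaw hp hρ n hc,
    ← E.map_eval_envLaw hρ (n : T), map_measureReal_apply (measurable_pi_apply (n : T)) hS]
  refine integral_le_add_measureReal
    (.of_mem_Icc a b (E.measurable_quenched_transition n m Φ 0).aemeasurable (ae_of_all _ hmem))
    (integrable_quenched hp n hc 0) (measurable_pi_apply _ hS) he (fun η hη => ?_)
    fun η => by linarith [(hmem η).2, (hmem_c η).1]
  rw [← quenched_add_const]
  exact quenched_mono hp η n fun y hy => h y (by simpa using hy) _ hη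

lemma le_integral_walkLaw_add [IsStrictOrderedRing T] (hp : JumpRates p₀ p₁) (hρ : ρ ∈ E.J)
    (n m : ℕ) (hΦ : ∀ x, Φ x ∈ Icc a b) {c : ℤ → ℝ} (hc : ∀ x, c x ∈ Icc a b) {e : ℝ}
    (he : 0 ≤ e) {S : Set Config} (hS : MeasurableSet S)
    (h : ∀ x : ℤ, |x| ≤ n → ∀ ζ ∉ S, c x ≤ E.transition p₀ p₁ m Φ x ζ + e) :
    ∫ x, c x ∂(E.walkLaw p₀ p₁ ρ n)
      ≤ ∫ x, Φ x ∂(E.walkLaw p₀ p₁ ρ (n + m)) + e + (b - a) * (E.μ ρ).real S := by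
  have hneg : ∀ {f : ℤ → ℝ}, (∀ x, f x ∈ Icc a b) → ∀ x, -f x ∈ Icc (-b) (-a) :=
    fun hf x => ⟨neg_le_neg (hf x).2, neg_le_neg (hf x).1⟩
  have hle := integral_walkLaw_add_le hp hρ n m (hneg hΦ) (hneg hc) he hS fun x hx ζ hζ => by
    rw [transition_neg]
    linarith [h x hx ζ hζ]
  rw [integral_neg, integral_neg] at hle
  linarith

/-- The total error made when the environment is refreshed. -/
def refreshError (E : Environment T) (ν ρ ε : ℝ) (H L ℓ : ℕ) (e : ℝ) : ℝ :=
  20 * Real.exp (-(ν * L / 4)) + e + (E.μ ρ).real (irregular ρ (ε / 4) H ℓ)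
    + (E.μ (ρ + ε)).real (irregular (ρ + ε) (ε / 4) H ℓ)

section Covers

variable [IsStrictOrderedRing T] {n t L H H' ℓ : ℕ} {e : ℝ}

lemma Covers.delayed_le_integral (hcov : E.Covers ν ρ ε H t ℓ e) (hdrift : E.NoDriftingIn ν)
    (hp : JumpRates p₀ p₁) (hρε : ρ + ε ∈ E.J) (he : 0 ≤ e) {y : ℤ}
    (hH' : |(y : ℝ)| + L + 2 * ν * L ≤ H') (hH : (H' : ℝ) ≤ H - 4 * ν * t) (hmono : ParityMono Φ)
    (hΦ : ∀ x, Φ x ∈ Icc a b) {ζ' : Config} (hζ' : ζ' ∉ irregular ρ (ε / 4) H ℓ) :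
    E.delayed p₀ p₁ t L Φ y ζ'
      ≤ ∫ x, Φ (y + x) ∂(E.walkLaw p₀ p₁ (ρ + ε) L)
        + (b - a) * (20 * Real.exp (-(ν * L / 4)) + e
          + (E.μ (ρ + ε)).real (irregular (ρ + ε) (ε / 4) H ℓ)) := by
  have := E.isProbabilityMeasure_μ _ hρε
  have hab : 0 ≤ b - a := sub_nonneg.2 ((hΦ 0).1.trans (hΦ 0).2)
  have hle := integral_le_add_measureReal (m := E.μ (ρ + ε)) (M := b - a)
    (integrable_const (E.delayed p₀ p₁ t L Φ y ζ'))
    (.of_mem_Icc a b (E.measurable_delayed t L Φ y).aemeasurable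
      (ae_of_all _ (E.delayed_mem_Icc hp t L hΦ y)))
    (measurableSet_irregular (ρ + ε) (ε / 4) H ℓ)
    (mul_nonneg hab (show 0 ≤ 20 * Real.exp (-(ν * L / 4)) + e by positivity))
    (fun ζ hζ => hcov.delayed_le hdrift hp hH' hH hζ' hζ hmono hΦ)
    fun ζ => by
      linarith [(E.delayed_mem_Icc hp t L hΦ y ζ').2, (E.delayed_mem_Icc hp t L hΦ y ζ).1]
  rw [integral_const, probReal_univ, one_smul, E.integral_delayed hp hρε t L hΦ] at hle
  linarith

lemma Covers.integral_le_delayed (hcov : E.Covers ν ρ ε H t ℓ e) (hdrift : E.NoDriftingIn ν)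
    (hp : JumpRates p₀ p₁) (hρ : ρ ∈ E.J) (he : 0 ≤ e) {y : ℤ}
    (hH' : |(y : ℝ)| + L + 2 * ν * L ≤ H') (hH : (H' : ℝ) ≤ H - 4 * ν * t) (hmono : ParityMono Φ)
    (hΦ : ∀ x, Φ x ∈ Icc a b) {ζ : Config} (hζ : ζ ∉ irregular (ρ + ε) (ε / 4) H ℓ) :
    ∫ x, Φ (y + x) ∂(E.walkLaw p₀ p₁ ρ L)
      ≤ E.delayed p₀ p₁ t L Φ y ζ
        + (b - a) * (20 * Real.exp (-(ν * L / 4)) + e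
          + (E.μ ρ).real (irregular ρ (ε / 4) H ℓ)) := by
  have := E.isProbabilityMeasure_μ _ hρ
  have hab : 0 ≤ b - a := sub_nonneg.2 ((hΦ 0).1.trans (hΦ 0).2)
  have hle := integral_le_add_measureReal (m := E.μ ρ) (M := b - a)
    (.of_mem_Icc a b (E.measurable_delayed t L Φ y).aemeasurable
      (ae_of_all _ (E.delayed_mem_Icc hp t L hΦ y)))
    (integrable_const (E.delayed p₀ p₁ t L Φ y ζ)) (measurableSet_irregular ρ (ε / 4) H ℓ)
    (mul_nonneg hab (show 0 ≤ 20 * Real.exp (-(ν * L / 4)) + e by positivity))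
    (fun ζ' hζ' => hcov.delayed_le hdrift hp hH' hH hζ' hζ hmono hΦ)
    fun ζ' => by
      linarith [(E.delayed_mem_Icc hp t L hΦ y ζ').2, (E.delayed_mem_Icc hp t L hΦ y ζ).1]
  rw [integral_const, probReal_univ, one_smul, E.integral_delayed hp hρ t L hΦ] at hle
  linarith

lemma abs_add_window_le (hH' : (n : ℝ) + t + L + 2 * ν * L ≤ H') {x y : ℤ} (hx : |x| ≤ (n : ℤ))
    (hy : |y| ≤ (t : ℤ)) : |((x + y : ℤ) : ℝ)| + L + 2 * ν * L ≤ H' := by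
  have hxy : |((x + y : ℤ) : ℝ)| ≤ n + t := by
    exact_mod_cast (abs_add_le x y).trans (add_le_add hx hy)
  linarith

lemma integral_mem_Icc_of_forall {m : Measure ℤ} [IsProbabilityMeasure m] {f : ℤ → ℝ}
    (hf : ∀ x, f x ∈ Icc a b) : ∫ x, f x ∂m ∈ Icc a b :=
  (convex_Icc a b).integral_mem isClosed_Icc (ae_of_all _ hf)
    (.of_mem_Icc a b (measurable_of_countable f).aemeasurable (ae_of_all _ hf))

lemma Covers.integral_walkLaw_le (hcov : E.Covers ν ρ ε H t ℓ e) (hdrift : E.NoDriftingIn ν)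
    (hp : JumpRates p₀ p₁) (hρ : ρ ∈ E.J) (hρε : ρ + ε ∈ E.J) (he : 0 ≤ e)
    (hH' : (n : ℝ) + t + L + 2 * ν * L ≤ H') (hH : (H' : ℝ) ≤ H - 4 * ν * t)
    (hmono : Monotone Φ) (hΦ : ∀ x, Φ x ∈ Icc a b) :
    ∫ x, Φ x ∂(E.walkLaw p₀ p₁ ρ (n + (t + L)))
      ≤ ∫ x, ∫ y, Φ (x + t + y) ∂(E.walkLaw p₀ p₁ (ρ + ε) L) ∂(E.walkLaw p₀ p₁ ρ n)
        + (b - a) * E.refreshError ν ρ ε H L ℓ e := by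
  have hab : 0 ≤ b - a := sub_nonneg.2 ((hΦ 0).1.trans (hΦ 0).2)
  have := E.isProbabilityMeasure_walkLaw (p₀ := p₀) (p₁ := p₁) hρε L
  have hpar : ParityMono Φ := .of_monotone hmono
  have hle := integral_walkLaw_add_le hp hρ n (t + L) hΦ
    (c := fun x => ∫ y, Φ (x + t + y) ∂(E.walkLaw p₀ p₁ (ρ + ε) L))
    (fun x => integral_mem_Icc_of_forall fun y => hΦ _) (mul_nonneg hab (by positivity))
    (measurableSet_irregular ρ (ε / 4) H ℓ) fun x hx ζ' hζ' =>
      (E.transition_add_mem_Icc hp t L hΦ hpar x ζ').2.trans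
        (hcov.delayed_le_integral hdrift hp hρε he (abs_add_window_le hH' hx (by simp)) hH hpar hΦ
          hζ')
  rw [refreshError]
  linarith

lemma Covers.le_integral_walkLaw (hcov : E.Covers ν ρ ε H t ℓ e) (hdrift : E.NoDriftingIn ν)
    (hp : JumpRates p₀ p₁) (hρ : ρ ∈ E.J) (hρε : ρ + ε ∈ E.J) (he : 0 ≤ e)
    (hH' : (n : ℝ) + t + L + 2 * ν * L ≤ H') (hH : (H' : ℝ) ≤ H - 4 * ν * t)
    (hmono : Monotone Φ) (hΦ : ∀ x, Φ x ∈ Icc a b) :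
    ∫ x, ∫ y, Φ (x - t + y) ∂(E.walkLaw p₀ p₁ ρ L) ∂(E.walkLaw p₀ p₁ (ρ + ε) n)
      ≤ ∫ x, Φ x ∂(E.walkLaw p₀ p₁ (ρ + ε) (n + (t + L)))
        + (b - a) * E.refreshError ν ρ ε H L ℓ e := by
  have hab : 0 ≤ b - a := sub_nonneg.2 ((hΦ 0).1.trans (hΦ 0).2)
  have := E.isProbabilityMeasure_walkLaw (p₀ := p₀) (p₁ := p₁) hρ L
  have hpar : ParityMono Φ := .of_monotone hmono
  have hle := le_integral_walkLaw_add hp hρε n (t + L) hΦ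
    (c := fun x => ∫ y, Φ (x - t + y) ∂(E.walkLaw p₀ p₁ ρ L))
    (fun x => integral_mem_Icc_of_forall fun y => hΦ _) (mul_nonneg hab (by positivity))
    (measurableSet_irregular (ρ + ε) (ε / 4) H ℓ) fun x hx ζ hζ =>
      (hcov.integral_le_delayed hdrift hp hρ he
        (abs_add_window_le hH' hx (y := -t) (by simp)) hH hpar hΦ hζ).trans
        (add_le_add_left (E.transition_add_mem_Icc hp t L hΦ hpar x ζ).1 _)
  rw [refreshError]
  linarith

end Covers

lemma covers_of_covering {e : ℝ} {H t : ℕ}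
    (h : ∀ η₀ η₀' : Config,
      (∀ a b : ℤ, -(H : ℤ) ≤ a → a ≤ b → b ≤ H →
        ⌊(t : ℝ) ^ (1 / 4 : ℝ)⌋ / 2 ≤ b - a + 1 → b - a + 1 ≤ ⌊(t : ℝ) ^ (1 / 4 : ℝ)⌋ →
          (ρ + 3 * ε / 4) * ((b - a + 1 : ℤ) : ℝ) ≤ count η₀ a b ∧
          (count η₀' a b : ℝ) ≤ (ρ + ε / 4) * ((b - a + 1 : ℤ) : ℝ)) →
      ∃ Q : Measure (EnvPath T × EnvPath T), IsCoupling Q (E.P η₀) (E.P η₀') ∧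
        1 - e ≤ Q.real {ω | ∀ x : ℤ, |(x : ℝ)| ≤ H - 4 * ν * t →
            ω.2 (t : T) x ≤ ω.1 (t : T) x}) :
    E.Covers ν ρ ε H t ⌊(t : ℝ) ^ (1 / 4 : ℝ)⌋₊ e := by
  intro ζ' hζ' ζ hζ
  refine h ζ ζ' fun a b ha hab hb hℓ hℓ' => ?_
  rw [← Int.natCast_floor_eq_floor (by positivity)] at hℓ hℓ'
  have hcount := abs_lt.1 (abs_count_sub_lt hζ ha hab hb hℓ hℓ')
  have hcount' := abs_lt.1 (abs_count_sub_lt hζ' ha hab hb hℓ hℓ')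
  constructor <;> linarith

end Environment

/-! ### Choice of the scales -/

lemma tendsto_natCast_rpow {a : ℝ} (ha : 0 < a) :
    Tendsto (fun L : ℕ => (L : ℝ) ^ a) atTop atTop :=
  (tendsto_rpow_atTop ha).comp tendsto_natCast_atTop_atTop

lemma eventually_mul_rpow_mul_exp_le {a b c : ℝ} (hb : 0 < b) (hba : b < a) (hc : 0 < c)
    (D s : ℝ) :
    ∀ᶠ x : ℝ in atTop, D * x ^ s * Real.exp (-(c * x ^ a)) ≤ Real.exp (-x ^ b) := by
  have hpoly : ∀ᶠ x : ℝ in atTop, D * (x ^ b) ^ (s / b) * Real.exp (-x ^ b) < 1 := by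
    have hlim := ((tendsto_rpow_mul_exp_neg_mul_atTop_nhds_zero (s / b) 1 one_pos).const_mul D).comp
      (tendsto_rpow_atTop hb)
    simp only [mul_zero, neg_mul, one_mul, ← mul_assoc] at hlim
    exact hlim.eventually_lt_const one_pos
  filter_upwards [hpoly, eventually_gt_atTop 0,
    (tendsto_rpow_atTop (sub_pos.2 hba)).eventually_ge_atTop (2 / c)] with x hx hx0 hxc
  have hdecay : 2 * x ^ b ≤ c * x ^ a := by
    rw [div_le_iff₀ hc] at hxc
    calc 2 * x ^ b ≤ x ^ (a - b) * c * x ^ b := by gcongr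
      _ = c * (x ^ (a - b) * x ^ b) := by ring
      _ = c * x ^ a := by rw [← Real.rpow_add hx0, sub_add_cancel]
  rw [← Real.rpow_mul hx0.le, mul_div_cancel₀ s hb.ne'] at hx
  calc D * x ^ s * Real.exp (-(c * x ^ a))
      = D * x ^ s * Real.exp (-x ^ b) * Real.exp (x ^ b - c * x ^ a) := by
        rw [mul_assoc _ (Real.exp _), ← Real.exp_add]
        ring_nf
    _ ≤ 1 * Real.exp (-x ^ b) := by
        refine mul_le_mul hx.le ?_ (Real.exp_pos _).le zero_le_one
        rw [Real.exp_le_exp]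
        linarith
    _ = Real.exp (-x ^ b) := one_mul _

lemma rpow_half_le_sqrt {L : ℕ} (hL : 16 ≤ L) : (L : ℝ) ^ (1 / 2 : ℝ) / 2 ≤ Nat.sqrt L := by
  have hsq : L ≤ (2 * Nat.sqrt L) ^ 2 := by
    have hL4 : 4 ≤ Nat.sqrt L := Nat.le_sqrt.2 hL
    exact (Nat.lt_succ_sqrt' L).le.trans (Nat.pow_le_pow_left (by omega) 2)
  have hle := Real.sqrt_le_sqrt (show (L : ℝ) ≤ (2 * Nat.sqrt L) ^ 2 by exact_mod_cast hsq)
  rw [Real.sqrt_sq (by positivity), Real.sqrt_eq_rpow] at hle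
  linarith

lemma rpow_eighth_le_sqrt_rpow {L : ℕ} (hL : 16 ≤ L) :
    (L : ℝ) ^ (1 / 8 : ℝ) / 2 ≤ (Nat.sqrt L : ℝ) ^ (1 / 4 : ℝ) :=
  calc (L : ℝ) ^ (1 / 8 : ℝ) / 2 ≤ (L : ℝ) ^ (1 / 8 : ℝ) / 2 ^ (1 / 4 : ℝ) := by
        gcongr
        exact (Real.rpow_le_rpow_of_exponent_le one_le_two (by norm_num)).trans_eq (Real.rpow_one 2)
    _ = ((L : ℝ) ^ (1 / 2 : ℝ) / 2) ^ (1 / 4 : ℝ) := by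
        rw [Real.div_rpow (by positivity) zero_le_two, ← Real.rpow_mul (by positivity)]
        norm_num
    _ ≤ (Nat.sqrt L : ℝ) ^ (1 / 4 : ℝ) := by
        gcongr
        exact rpow_half_le_sqrt hL

lemma half_rpow_le_sq_mul_sqrt_rpow {L : ℕ} (hL : 16 ≤ L) {ε : ℝ}
    (hε : (L : ℝ) ^ (-(1 / 100) : ℝ) ≤ ε) :
    (L : ℝ) ^ (1 / 10 : ℝ) / 2 ≤ ε ^ 2 * (Nat.sqrt L : ℝ) ^ (1 / 4 : ℝ) := by
  have hL1 : (1 : ℝ) ≤ L := by exact_mod_cast (by omega : 1 ≤ L)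
  calc (L : ℝ) ^ (1 / 10 : ℝ) / 2 ≤ (L : ℝ) ^ (-(1 / 100) * 2 + 1 / 8 : ℝ) / 2 := by
        gcongr
        norm_num
    _ = ((L : ℝ) ^ (-(1 / 100) : ℝ)) ^ 2 * ((L : ℝ) ^ (1 / 8 : ℝ) / 2) := by
        rw [Real.rpow_add (by positivity), Real.rpow_mul (by positivity), Real.rpow_two]
        ring
    _ ≤ ε ^ 2 * (Nat.sqrt L : ℝ) ^ (1 / 4 : ℝ) := by
        gcongr
        exact rpow_eighth_le_sqrt_rpow hL

lemma log_mul_sqrt_pow_three_le {ν : ℝ} (hν : 0 < ν) {L : ℕ} (h : 1 ≤ ν * Nat.sqrt L) :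
    Real.log (ν * Nat.sqrt L) ^ 3 ≤ 27000 * (ν ^ (1 / 10 : ℝ) * (L : ℝ) ^ (1 / 20 : ℝ)) := by
  have hsqrt : (Nat.sqrt L : ℝ) ≤ (L : ℝ) ^ (1 / 2 : ℝ) := by
    rw [← Real.sqrt_eq_rpow]
    exact Real.nat_sqrt_le_real_sqrt
  calc Real.log (ν * Nat.sqrt L) ^ 3
      ≤ ((ν * Nat.sqrt L) ^ (1 / 30 : ℝ) / (1 / 30)) ^ 3 :=
        pow_le_pow_left₀ (Real.log_nonneg h)
          (Real.log_le_rpow_div (by positivity) (by norm_num)) 3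
    _ ≤ ((ν * (L : ℝ) ^ (1 / 2 : ℝ)) ^ (1 / 30 : ℝ) / (1 / 30)) ^ 3 := by gcongr
    _ = 27000 * (ν ^ (1 / 10 : ℝ) * (L : ℝ) ^ (1 / 20 : ℝ)) := by
        rw [div_pow, ← Real.rpow_natCast, ← Real.rpow_mul (by positivity),
          Real.mul_rpow hν.le (by positivity), ← Real.rpow_mul (by positivity)]
        norm_num
        ring

lemma eventually_lt_mul_sqrt {ν : ℝ} (hν : 0 < ν) (a : ℝ) :
    ∀ᶠ L : ℕ in atTop, a < ν * Nat.sqrt L := by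
  have hlim : Tendsto (fun L : ℕ => ν * ((L : ℝ) ^ (1 / 2 : ℝ) / 2)) atTop atTop :=
    ((tendsto_natCast_rpow (by norm_num)).atTop_div_const two_pos).const_mul_atTop hν
  filter_upwards [hlim.eventually_gt_atTop a, eventually_ge_atTop 16] with L ha hL
  refine ha.trans_le ?_
  gcongr
  exact rpow_half_le_sqrt hL

lemma eventually_mul_log_pow_three_lt {ν : ℝ} (hν : 0 < ν) {C : ℝ} (hC : 0 < C) :
    ∀ᶠ L : ℕ in atTop, C * (L : ℝ) ^ (1 / 50 : ℝ) * (1 + |Real.log (ν * Nat.sqrt L) ^ 3|)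
      < ν * (Nat.sqrt L : ℝ) ^ (1 / 4 : ℝ) := by
  filter_upwards [eventually_ge_atTop 16, eventually_lt_mul_sqrt hν 1,
    (tendsto_natCast_rpow (a := 11 / 200) (by norm_num)).eventually_gt_atTop
      (2 * C * (1 + 27000 * ν ^ (1 / 10 : ℝ)) / ν)] with L hL hνL hlarge
  have hL1 : (1 : ℝ) ≤ L := by exact_mod_cast (by omega : 1 ≤ L)
  have hL0 : (0 : ℝ) < L := one_pos.trans_le hL1
  have hlog := log_mul_sqrt_pow_three_le hν hνL.le
  have hone : (1 : ℝ) ≤ (L : ℝ) ^ (1 / 20 : ℝ) := Real.one_le_rpow hL1 (by norm_num)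
  rw [abs_of_nonneg (pow_nonneg (Real.log_nonneg hνL.le) 3)]
  rw [div_lt_iff₀ hν] at hlarge
  calc C * (L : ℝ) ^ (1 / 50 : ℝ) * (1 + Real.log (ν * Nat.sqrt L) ^ 3)
      ≤ C * (L : ℝ) ^ (1 / 50 : ℝ) * ((L : ℝ) ^ (1 / 20 : ℝ)
          + 27000 * (ν ^ (1 / 10 : ℝ) * (L : ℝ) ^ (1 / 20 : ℝ))) := by gcongr
    _ = C * (1 + 27000 * ν ^ (1 / 10 : ℝ)) * ((L : ℝ) ^ (1 / 50 : ℝ) * (L : ℝ) ^ (1 / 20 : ℝ)) := by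
        ring
    _ < (L : ℝ) ^ (11 / 200 : ℝ) * ν / 2 * ((L : ℝ) ^ (1 / 50 : ℝ) * (L : ℝ) ^ (1 / 20 : ℝ)) := by
        gcongr
        linarith
    _ = ν * ((L : ℝ) ^ (1 / 8 : ℝ) / 2) := by
        rw [show (1 / 8 : ℝ) = 11 / 200 + (1 / 50 + 1 / 20) by norm_num, Real.rpow_add hL0,
          Real.rpow_add hL0]
        ring
    _ ≤ ν * (Nat.sqrt L : ℝ) ^ (1 / 4 : ℝ) := by
        gcongr
        exact rpow_eighth_le_sqrt_rpow hL

lemma exists_nested_windows {ν : ℝ} (hν : 0 ≤ ν) {L t : ℕ} (hL : 1 ≤ L) (htL : t ≤ L) (n : ℕ) :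
    ∃ H H' : ℕ, (n : ℝ) + t + L + 2 * ν * L ≤ H' ∧ (H' : ℝ) ≤ H - 4 * ν * t ∧
      (H : ℝ) ≤ (n + 1) * (6 * ν + 5) * L := by
  have hL1 : (1 : ℝ) ≤ L := by exact_mod_cast hL
  have htL' : (t : ℝ) ≤ L := by exact_mod_cast htL
  have hceil' := Nat.ceil_lt_add_one (show 0 ≤ (n : ℝ) + t + L + 2 * ν * L by positivity)
  have hceil := Nat.ceil_lt_add_one
    (show 0 ≤ (⌈(n : ℝ) + t + L + 2 * ν * L⌉₊ : ℝ) + 4 * ν * t by positivity)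
  refine ⟨_, _, Nat.le_ceil _, le_sub_iff_add_le.2 (Nat.le_ceil _), ?_⟩
  have hνt : ν * t ≤ ν * L := by gcongr
  have hn : 0 ≤ n * ((L : ℝ) - 1) := mul_nonneg n.cast_nonneg (sub_nonneg.2 hL1)
  have hnνL : 0 ≤ n * (ν * L) := by positivity
  linarith [mul_nonneg (n.cast_nonneg (α := ℝ)) (L.cast_nonneg (α := ℝ))]

namespace Environment

variable {T : Type} [CommSemiring T] [LinearOrder T] {E : Environment T} {ν ρ ε : ℝ}

lemma measureReal_irregular_sqrt_le {c : ℝ} (hc : 0 ≤ c) (hρ : ρ ∈ E.J)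
    (hdens : ∀ m : ℕ, 1 ≤ m →
      (E.μ ρ).real (atypical ρ (ε / 4) 0 m) ≤ 2 * Real.exp (-c * (ε / 4) ^ 2 * m))
    {L : ℕ} (hL : 16 ≤ L) (hL8 : 8 ≤ (L : ℝ) ^ (1 / 8 : ℝ))
    (hε : (L : ℝ) ^ (-(1 / 100) : ℝ) ≤ ε) (H : ℕ) :
    (E.μ ρ).real (irregular ρ (ε / 4) H ⌊(Nat.sqrt L : ℝ) ^ (1 / 4 : ℝ)⌋₊)
      ≤ (2 * H + 1) * (L * (2 * Real.exp (-(c / 128 * (L : ℝ) ^ (1 / 10 : ℝ))))) := by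
  set t := Nat.sqrt L
  set ℓ := ⌊(t : ℝ) ^ (1 / 4 : ℝ)⌋₊
  have ht1 : (1 : ℝ) ≤ t := by exact_mod_cast (Nat.le_sqrt.2 (by omega) : 1 ≤ t)
  have hℓL : (ℓ : ℝ) ≤ L :=
    calc (ℓ : ℝ) ≤ (t : ℝ) ^ (1 / 4 : ℝ) := Nat.floor_le (by positivity)
      _ ≤ (t : ℝ) ^ (1 : ℝ) := Real.rpow_le_rpow_of_exponent_le ht1 (by norm_num)
      _ = t := Real.rpow_one _
      _ ≤ L := by exact_mod_cast Nat.sqrt_le_self L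
  have hℓt : (t : ℝ) ^ (1 / 4 : ℝ) / 4 ≤ (ℓ - 1) / 2 := by
    linarith [rpow_eighth_le_sqrt_rpow hL, Nat.sub_one_lt_floor ((t : ℝ) ^ (1 / 4 : ℝ))]
  have hexp : c / 128 * (L : ℝ) ^ (1 / 10 : ℝ) ≤ c * (ε / 4) ^ 2 * ((ℓ - 1) / 2) :=
    calc c / 128 * (L : ℝ) ^ (1 / 10 : ℝ) = c / 64 * ((L : ℝ) ^ (1 / 10 : ℝ) / 2) := by ring
      _ ≤ c / 64 * (ε ^ 2 * (t : ℝ) ^ (1 / 4 : ℝ)) := by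
          gcongr
          exact half_rpow_le_sq_mul_sqrt_rpow hL hε
      _ = c * (ε / 4) ^ 2 * ((t : ℝ) ^ (1 / 4 : ℝ) / 4) := by ring
      _ ≤ c * (ε / 4) ^ 2 * ((ℓ - 1) / 2) := by gcongr
  refine (E.measureReal_irregular_le (κ := c * (ε / 4) ^ 2) (by positivity) hρ
    (by simpa only [neg_mul] using hdens) H ℓ).trans ?_
  gcongr
  linarith

lemma refreshError_le {n H L ℓ : ℕ} {A C X : ℝ} (hL : 1 ≤ L) (hC : 0 ≤ C)
    (hH : (H : ℝ) ≤ (n + 1) * A * L) (hdrift : Real.exp (-(ν * L / 4)) ≤ X) {e : ℝ}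
    (he : e ≤ C * L * H * X)
    (hirr : (E.μ ρ).real (irregular ρ (ε / 4) H ℓ) ≤ (2 * H + 1) * (L * (2 * X)))
    (hirr' : (E.μ (ρ + ε)).real (irregular (ρ + ε) (ε / 4) H ℓ)
      ≤ (2 * H + 1) * (L * (2 * X))) :
    E.refreshError ν ρ ε H L ℓ e
      ≤ (n + 1) * ((20 + C * A + (8 * A + 4)) * (L : ℝ) ^ (2 : ℝ) * X) := by
  have hL1 : (1 : ℝ) ≤ L := by exact_mod_cast hL
  have hX : 0 ≤ X := (Real.exp_pos _).le.trans hdrift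
  have hnL : (1 : ℝ) ≤ (n + 1) * L := one_le_mul_of_one_le_of_one_le (by simp) hL1
  calc E.refreshError ν ρ ε H L ℓ e
      ≤ 20 * X + C * L * H * X + (2 * H + 1) * (L * (2 * X)) + (2 * H + 1) * (L * (2 * X)) :=
        add_le_add (add_le_add (add_le_add (by gcongr) he) hirr) hirr'
    _ = (20 + (C * H + 8 * H + 4) * L) * X := by ring
    _ ≤ (20 * ((n + 1) * L * L) + (C * ((n + 1) * A * L) + 8 * ((n + 1) * A * L)
          + 4 * ((n + 1) * L)) * L) * X := by
        gcongr
        · exact le_mul_of_one_le_right (by norm_num) (one_le_mul_of_one_le_of_one_le hnL hL1)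
        · exact le_mul_of_one_le_right (by norm_num) hnL
    _ = (n + 1) * ((20 + C * A + (8 * A + 4)) * (L : ℝ) ^ (2 : ℝ) * X) := by
        rw [Real.rpow_two]
        ring

lemma Covering.exists_covers (hcover : E.Covering ν) (hν : 0 < ν) :
    ∃ C c : ℝ, 0 < C ∧ 0 < c ∧ ∀ᶠ L : ℕ in atTop, ∀ ρ ε : ℝ, ρ ∈ E.J → ρ + ε ∈ E.J → ε < 1 →
      (L : ℝ) ^ (-(1 / 100) : ℝ) ≤ ε → ∀ H : ℕ, 4 * ν * Nat.sqrt L < H →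
        E.Covers ν ρ ε H (Nat.sqrt L) ⌊(Nat.sqrt L : ℝ) ^ (1 / 4 : ℝ)⌋₊
          (C * L * H * Real.exp (-(c * (L : ℝ) ^ (1 / 10 : ℝ)))) := by
  obtain ⟨C₀, C, hC₀, hC, hcov⟩ := hcover
  refine ⟨C, (C * (1 + ν⁻¹))⁻¹ / 2, hC, by positivity, ?_⟩
  filter_upwards [eventually_mul_log_pow_three_lt hν hC₀,
    eventually_lt_mul_sqrt (pow_pos hν 8) 1, eventually_ge_atTop 16] with L hlog hν8 hL
    ρ ε hρ hρε hε1 hε H hH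
  have hL0 : (0 : ℝ) < L := by exact_mod_cast (by omega : 0 < L)
  have hε0 : 0 < ε := (Real.rpow_pos_of_pos hL0 _).trans_le hε
  have ht : 1 ≤ Nat.sqrt L := Nat.le_sqrt.2 (by omega)
  have hH1 : 1 ≤ H := by exact_mod_cast (show 0 ≤ 4 * ν * Nat.sqrt L by positivity).trans_lt hH
  have hε2 : (ε ^ 2)⁻¹ ≤ (L : ℝ) ^ (1 / 50 : ℝ) := by
    rw [inv_le_comm₀ (by positivity) (by positivity), ← Real.rpow_neg hL0.le]
    calc (L : ℝ) ^ (-(1 / 50) : ℝ) = ((L : ℝ) ^ (-(1 / 100) : ℝ)) ^ 2 := by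
          rw [← Real.rpow_two, ← Real.rpow_mul hL0.le]
          norm_num
      _ ≤ ε ^ 2 := by gcongr
  have hscale : C₀ * (ε ^ 2)⁻¹ * (1 + |Real.log (ν * Nat.sqrt L) ^ 3|)
      < ν * (Nat.sqrt L : ℝ) ^ (1 / 4 : ℝ) := by
    refine lt_of_le_of_lt ?_ hlog
    gcongr
  refine (covers_of_covering
    (hcov ρ hρ ε ⟨hε0, hε1⟩ hρε H (Nat.sqrt L) hH1 ht hH hν8 hscale)).mono ?_
  gcongr C * ?_ * H * Real.exp ?_
  · exact_mod_cast Nat.sqrt_le_self L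
  · rw [neg_le_neg_iff]
    calc (C * (1 + ν⁻¹))⁻¹ / 2 * (L : ℝ) ^ (1 / 10 : ℝ)
        = (C * (1 + ν⁻¹))⁻¹ * ((L : ℝ) ^ (1 / 10 : ℝ) / 2) := by ring
      _ ≤ (C * (1 + ν⁻¹))⁻¹ * (ε ^ 2 * (Nat.sqrt L : ℝ) ^ (1 / 4 : ℝ)) := by
          gcongr
          exact half_rpow_le_sq_mul_sqrt_rpow hL hε
      _ = (C * (1 + ν⁻¹))⁻¹ * ε ^ 2 * (Nat.sqrt L : ℝ) ^ (1 / 4 : ℝ) := by ring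

lemma eventually_exists_refreshError_le (hν : 0 < ν) (hcover : E.Covering ν) :
    ∀ᶠ L : ℕ in atTop, ∀ ρ ε : ℝ, ρ ∈ E.J → ρ + ε ∈ E.J → ε < 1 →
      (L : ℝ) ^ (-(1 / 100) : ℝ) ≤ ε → ∀ n : ℕ, ∃ (ℓ H H' : ℕ) (e : ℝ), 0 ≤ e ∧
        E.Covers ν ρ ε H (Nat.sqrt L) ℓ e ∧
        (n : ℝ) + Nat.sqrt L + L + 2 * ν * L ≤ H' ∧ (H' : ℝ) ≤ H - 4 * ν * Nat.sqrt L ∧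
        E.refreshError ν ρ ε H L ℓ e ≤ (n + 1) * Real.exp (-(L : ℝ) ^ (1 / 20 : ℝ)) := by
  obtain ⟨C, c, hC, hc, hcov⟩ := hcover.exists_covers hν
  obtain ⟨c₁, hc₁, hdens⟩ := E.density
  set c₀ := min (ν / 4) (min c (c₁ / 128))
  have hc₀ : 0 < c₀ := by positivity
  have hc₀_le : c₀ ≤ ν / 4 ∧ c₀ ≤ c ∧ c₀ ≤ c₁ / 128 := by simp [c₀]
  filter_upwards [hcov, eventually_ge_atTop 16,
    (tendsto_natCast_rpow (a := 1 / 8) (by norm_num)).eventually_ge_atTop 8,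
    tendsto_natCast_atTop_atTop.eventually (eventually_mul_rpow_mul_exp_le
      (show (0 : ℝ) < 1 / 20 by norm_num) (show (1 / 20 : ℝ) < 1 / 10 by norm_num) hc₀
      (20 + C * (6 * ν + 5) + (8 * (6 * ν + 5) + 4)) 2)] with L hcov hL hL8 hexp
    ρ ε hρ hρε hε1 hε n
  have hL1 : (1 : ℝ) ≤ L := by exact_mod_cast (by omega : 1 ≤ L)
  have hε0 : 0 < ε := (Real.rpow_pos_of_pos (by positivity) _).trans_le hε
  obtain ⟨H, H', hH', hH, hHL⟩ :=
    exists_nested_windows hν.le (by omega : 1 ≤ L) (Nat.sqrt_le_self L) n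
  have hHpos : 4 * ν * Nat.sqrt L < H := by
    have hH'pos : (0 : ℝ) < H' := lt_of_lt_of_le (by positivity) hH'
    linarith
  have hLexp : (L : ℝ) ^ (1 / 10 : ℝ) ≤ L :=
    (Real.rpow_le_rpow_of_exponent_le hL1 (by norm_num)).trans_eq (Real.rpow_one _)
  have hdrift : Real.exp (-(ν * L / 4)) ≤ Real.exp (-(c₀ * (L : ℝ) ^ (1 / 10 : ℝ))) := by
    rw [Real.exp_le_exp, neg_le_neg_iff, mul_div_right_comm]
    exact mul_le_mul hc₀_le.1 hLexp (by positivity) (by positivity)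
  have hirr : ∀ ρ' ∈ E.J,
      (E.μ ρ').real (irregular ρ' (ε / 4) H ⌊(Nat.sqrt L : ℝ) ^ (1 / 4 : ℝ)⌋₊)
        ≤ (2 * H + 1) * (L * (2 * Real.exp (-(c₀ * (L : ℝ) ^ (1 / 10 : ℝ))))) := fun ρ' hρ' =>
    (measureReal_irregular_sqrt_le hc₁.le hρ' (fun m hm => by
      simpa [atypical] using hdens ρ' hρ' (ε / 4) ⟨by positivity, by linarith⟩ m hm)
      hL hL8 hε H).trans (by gcongr; exact hc₀_le.2.2)
  refine ⟨_, H, H', _, by positivity, hcov ρ ε hρ hρε hε1 hε H hHpos, hH', hH,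
    (refreshError_le (by omega) hC.le hHL hdrift ?_ (hirr ρ hρ)
      (hirr _ hρε)).trans (by gcongr)⟩
  gcongr
  exact hc₀_le.2.1

end Environment

/-! ### Refreshment inequalities between families of laws on `ℤ` -/

/-- A family of probability measures on `ℤ`, the `n`-th of which is carried by `[-n, n]`, like the
law at time `n` of a nearest-neighbour walk. -/
structure IsWalkLaw (A : ℕ → Measure ℤ) : Prop where
  prob : ∀ n, IsProbabilityMeasure (A n)
  ae_abs_le : ∀ n : ℕ, ∀ᵐ x ∂(A n), |x| ≤ (n : ℤ)

lemma IsWalkLaw.integrable {A : ℕ → Measure ℤ} (hA : IsWalkLaw A) (n : ℕ) (f : ℤ → ℝ) :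
    Integrable f (A n) := by
  have := hA.prob n
  refine Integrable.of_bound (measurable_of_countable f).aestronglyMeasurable
    (∑ x ∈ Finset.Icc (-(n : ℤ)) n, ‖f x‖) ?_
  filter_upwards [hA.ae_abs_le n] with x hx
  exact Finset.single_le_sum (f := fun x => ‖f x‖) (fun _ _ => norm_nonneg _)
    (Finset.mem_Icc.2 (abs_le.1 hx))

/-- The family of laws of the reflected walk. -/
def reflect (A : ℕ → Measure ℤ) (n : ℕ) : Measure ℤ := (A n).map Neg.neg

lemma integral_reflect (A : ℕ → Measure ℤ) (n : ℕ) (f : ℤ → ℝ) :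
    ∫ x, f x ∂(reflect A n) = ∫ x, f (-x) ∂(A n) :=
  integral_map measurable_neg.aemeasurable (measurable_of_countable f).aestronglyMeasurable

lemma IsWalkLaw.reflect {A : ℕ → Measure ℤ} (hA : IsWalkLaw A) : IsWalkLaw (reflect A) where
  prob n := by
    have := hA.prob n
    exact Measure.isProbabilityMeasure_map measurable_neg.aemeasurable
  ae_abs_le n := by
    rw [RWDRE.reflect, ae_map_iff measurable_neg.aemeasurable .of_discrete]
    simpa only [abs_neg] using hA.ae_abs_le n

/-- The error made when the environment is refreshed at time `n` for a duration of order `L`. -/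
def refreshRate (n L : ℕ) : ℝ := (n + 1) * Real.exp (-(L : ℝ) ^ (1 / 20 : ℝ))

lemma refreshRate_nonneg (n L : ℕ) : 0 ≤ refreshRate n L := by
  unfold refreshRate
  positivity

lemma refreshRate_le {m n : ℕ} (h : m ≤ n) (L : ℕ) : refreshRate m L ≤ refreshRate n L := by
  unfold refreshRate
  gcongr

/-- Up to a small error, the increment over a time `√L + L` under `A` is dominated by `√L` plus an
independent increment over a time `L` under `A'`. -/
def Refreshes (A A' : ℕ → Measure ℤ) (L : ℕ) : Prop :=
  ∀ n : ℕ, ∀ Φ : ℤ → ℝ, Monotone Φ →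
    ∫ x, Φ x ∂(A (n + (Nat.sqrt L + L)))
      ≤ ∫ x, ∫ y, Φ (x + Nat.sqrt L + y) ∂(A' L) ∂(A n)
        + (Φ ((n + (Nat.sqrt L + L) : ℕ) : ℤ) - Φ (-((n + (Nat.sqrt L + L) : ℕ) : ℤ)))
          * refreshRate n L

lemma refreshes_of_bounded {A A' : ℕ → Measure ℤ} (hA : IsWalkLaw A) (hA' : IsWalkLaw A') {L : ℕ}
    (h : ∀ n : ℕ, ∀ Φ : ℤ → ℝ, Monotone Φ → ∀ a b, (∀ x, Φ x ∈ Icc a b) →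
      ∫ x, Φ x ∂(A (n + (Nat.sqrt L + L)))
        ≤ ∫ x, ∫ y, Φ (x + Nat.sqrt L + y) ∂(A' L) ∂(A n) + (b - a) * refreshRate n L) :
    Refreshes A A' L := by
  intro n Φ hΦ
  set R : ℤ := ((n + (Nat.sqrt L + L) : ℕ) : ℤ)
  have htrunc : ∀ {x : ℤ}, |x| ≤ R → max (-R) (min x R) = x := fun hx => by
    rw [min_eq_left (abs_le.1 hx).2, max_eq_right (abs_le.1 hx).1]
  have hle := h n (fun x => Φ (max (-R) (min x R)))
    (fun x y hxy => hΦ (max_le_max le_rfl (min_le_min hxy le_rfl))) (Φ (-R)) (Φ R)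
    fun x => ⟨hΦ (le_max_left _ _), hΦ (max_le (by omega) (min_le_right _ _))⟩
  have hleft : ∫ x, Φ (max (-R) (min x R)) ∂(A (n + (Nat.sqrt L + L)))
      = ∫ x, Φ x ∂(A (n + (Nat.sqrt L + L))) := by
    refine integral_congr_ae ?_
    filter_upwards [hA.ae_abs_le _] with x hx
    rw [htrunc hx]
  have hright : ∫ x, ∫ y, Φ (max (-R) (min (x + Nat.sqrt L + y) R)) ∂(A' L) ∂(A n)
      = ∫ x, ∫ y, Φ (x + Nat.sqrt L + y) ∂(A' L) ∂(A n) := by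
    refine integral_congr_ae ?_
    filter_upwards [hA.ae_abs_le n] with x hx
    refine integral_congr_ae ?_
    filter_upwards [hA'.ae_abs_le L] with y hy
    rw [htrunc]
    rw [abs_le] at *
    omega
  rwa [hleft, hright] at hle

namespace Environment

variable {T : Type} [CommSemiring T] [LinearOrder T] {E : Environment T} {p₀ p₁ ν : ℝ}

lemma isWalkLaw_walkLaw {ρ : ℝ} (hρ : ρ ∈ E.J) : IsWalkLaw (E.walkLaw p₀ p₁ ρ) :=
  ⟨fun n => E.isProbabilityMeasure_walkLaw hρ n, fun n => E.ae_walkLaw_abs_le ρ n⟩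

lemma eventually_refreshes [IsStrictOrderedRing T] (hν : 0 < ν) (hdrift : E.NoDriftingIn ν)
    (hcover : E.Covering ν) (hp : JumpRates p₀ p₁) :
    ∀ᶠ L : ℕ in atTop, ∀ ρ ∈ E.J, ∀ ρ' ∈ E.J, ρ' < ρ + 1 →
      ρ + (L : ℝ) ^ (-(1 / 100) : ℝ) ≤ ρ' →
      Refreshes (E.walkLaw p₀ p₁ ρ) (E.walkLaw p₀ p₁ ρ') L ∧
      Refreshes (reflect (E.walkLaw p₀ p₁ ρ')) (reflect (E.walkLaw p₀ p₁ ρ)) L := by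
  filter_upwards [eventually_exists_refreshError_le hν hcover] with L h ρ hρ ρ' hρ' hlt hle
  obtain ⟨ε, rfl⟩ : ∃ ε, ρ' = ρ + ε := ⟨ρ' - ρ, by ring⟩
  have hε1 : ε < 1 := by linarith
  have hε : (L : ℝ) ^ (-(1 / 100) : ℝ) ≤ ε := by linarith
  constructor
  · refine refreshes_of_bounded (isWalkLaw_walkLaw hρ) (isWalkLaw_walkLaw hρ')
      fun n Φ hmono a b hΦ => ?_
    obtain ⟨ℓ, H, H', e, he, hcov, hH', hH, herr⟩ := h ρ ε hρ hρ' hε1 hε n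
    have hab : 0 ≤ b - a := sub_nonneg.2 ((hΦ 0).1.trans (hΦ 0).2)
    exact (hcov.integral_walkLaw_le hdrift hp hρ hρ' he hH' hH hmono hΦ).trans
      (by rw [refreshRate]; gcongr)
  · refine refreshes_of_bounded (isWalkLaw_walkLaw hρ').reflect (isWalkLaw_walkLaw hρ).reflect
      fun n Φ hmono a b hΦ => ?_
    obtain ⟨ℓ, H, H', e, he, hcov, hH', hH, herr⟩ := h ρ ε hρ hρ' hε1 hε n
    have hab : 0 ≤ b - a := sub_nonneg.2 ((hΦ 0).1.trans (hΦ 0).2)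
    have hle := hcov.le_integral_walkLaw hdrift hp hρ hρ' he hH' hH
      (Φ := fun x => -Φ (-x)) (fun x y hxy => neg_le_neg (hmono (neg_le_neg hxy)))
      fun x => ⟨neg_le_neg (hΦ _).2, neg_le_neg (hΦ _).1⟩
    have herr' := mul_le_mul_of_nonneg_left herr hab
    have hreflect : ∀ x y : ℤ, -(x - Nat.sqrt L + y) = -x + Nat.sqrt L + -y := fun x y => by ring
    simp only [integral_neg, hreflect] at hle
    simp only [integral_reflect, refreshRate]
    linarith

end Environment

/-! ### Comparison of the mean displacements -/

/-- The mean displacement at time `n`. -/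
def mean (A : ℕ → Measure ℤ) (n : ℕ) : ℝ := ∫ x, (x : ℝ) ∂(A n)

lemma mean_reflect (A : ℕ → Measure ℤ) (n : ℕ) : mean (reflect A) n = -mean A n := by
  simp [mean, integral_reflect, integral_neg]

section Mean

variable {A A' : ℕ → Measure ℤ} {L : ℕ}

lemma IsWalkLaw.abs_mean_le (hA : IsWalkLaw A) (n : ℕ) : |mean A n| ≤ n := by
  have := hA.prob n
  have hbound : ∀ᵐ x : ℤ ∂(A n), ‖(x : ℝ)‖ ≤ n := by
    filter_upwards [hA.ae_abs_le n] with x hx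
    rw [Real.norm_eq_abs]
    exact_mod_cast hx
  simpa [mean] using norm_integral_le_of_norm_le_const hbound

lemma Refreshes.mean_le (h : Refreshes A A' L) (hA : IsWalkLaw A) (hA' : IsWalkLaw A') (n : ℕ) :
    mean A (n + (Nat.sqrt L + L)) ≤ mean A n + (Nat.sqrt L + mean A' L)
      + 2 * (n + (Nat.sqrt L + L) : ℕ) * refreshRate n L := by
  have := hA.prob n
  have := hA'.prob L
  have hinner : ∀ x : ℤ, ∫ y, ((x + Nat.sqrt L + y : ℤ) : ℝ) ∂(A' L)
      = x + (Nat.sqrt L + mean A' L) := fun x => by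
    push_cast
    rw [integral_add (integrable_const _) (hA'.integrable _ _)]
    simp [mean, add_assoc]
  have houter : ∫ x, ((x : ℝ) + (Nat.sqrt L + mean A' L)) ∂(A n)
      = mean A n + (Nat.sqrt L + mean A' L) := by
    rw [integral_add (hA.integrable _ _) (integrable_const _)]
    simp [mean]
  have hle := h n (fun x => (x : ℝ)) Int.cast_mono
  simp only [hinner, houter, Int.cast_neg, Int.cast_natCast] at hle
  rw [mean, two_mul]
  linarith

lemma Refreshes.mean_iterate_le (h : Refreshes A A' L) (hA : IsWalkLaw A) (hA' : IsWalkLaw A')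
    (r k N : ℕ) (hN : r + k * (Nat.sqrt L + L) ≤ N) :
    mean A (r + k * (Nat.sqrt L + L)) ≤ r + k * (Nat.sqrt L + mean A' L)
      + k * (2 * N * refreshRate N L) := by
  induction k with
  | zero => simpa using (abs_le.1 (hA.abs_mean_le r)).2
  | succ k ih =>
    set m := r + k * (Nat.sqrt L + L)
    have hsucc : r + (k + 1) * (Nat.sqrt L + L) = m + (Nat.sqrt L + L) := by ring
    rw [hsucc] at hN ⊢
    have herr : 2 * ((m + (Nat.sqrt L + L) : ℕ) : ℝ) * refreshRate m L
        ≤ 2 * N * refreshRate N L := by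
      have hrate := refreshRate_le (by omega : m ≤ N) L
      have hrate0 := refreshRate_nonneg m L
      gcongr
    have ih := ih (by omega)
    have hstep := h.mean_le hA hA' m
    push_cast at herr hstep ⊢
    linarith

lemma Refreshes.mean_le_mul_add (h : Refreshes A A' L) (hA : IsWalkLaw A) (hA' : IsWalkLaw A')
    (hL : 1 ≤ L) (N : ℕ) :
    mean A N ≤ mean A' L / L * N + 2 * (2 * L + N * (Nat.sqrt L / L))
      + N * (2 * N * refreshRate N L) := by
  have hL0 : (0 : ℝ) < L := by exact_mod_cast hL
  set t := Nat.sqrt L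
  set k := N / (t + L)
  set r := N % (t + L)
  set u := mean A' L / L
  have hN : r + k * (t + L) = N := by
    rw [add_comm, mul_comm]
    exact Nat.div_add_mod N (t + L)
  have hNcast : (N : ℝ) = r + k * (t + L) := by exact_mod_cast hN.symm
  have hle : mean A N ≤ r + k * (t + u * L) + k * (2 * N * refreshRate N L) := by
    have hiter := h.mean_iterate_le hA hA' r k N hN.le
    rwa [hN, ← div_mul_cancel₀ (mean A' L) hL0.ne'] at hiter
  have hu : -1 ≤ u := (abs_le.1 (by
    rw [abs_div, Nat.abs_cast]
    exact div_le_one_of_le₀ (hA'.abs_mean_le L) hL0.le)).1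
  have hr : (r : ℝ) ≤ 2 * L := by
    have hrlt : r < t + L := Nat.mod_lt _ (by omega)
    have htL : t ≤ L := Nat.sqrt_le_self L
    exact_mod_cast (by omega : r ≤ 2 * L)
  have hkt : (k : ℝ) * t ≤ N * (t / L) := by
    rw [← mul_div_assoc, le_div_iff₀ hL0, hNcast]
    have hsq : 0 ≤ (r + k * t : ℝ) * t := by positivity
    linarith
  have hk : k * (2 * N * refreshRate N L) ≤ N * (2 * N * refreshRate N L) := by
    have hrate := refreshRate_nonneg N L
    have hkN : k ≤ N := Nat.div_le_self _ _
    gcongr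
  have hslow : (r + k * t) * -u ≤ (r + k * t) * 1 := by
    gcongr
    linarith
  have hsplit : u * N = u * (r + k * t) + k * (u * L) := by
    rw [hNcast]
    ring
  linarith

lemma eventually_mean_error_le :
    ∀ᶠ L : ℕ in atTop, 6 * (L : ℝ) ^ (-(1 / 2) : ℝ)
      + 4 * (L : ℝ) ^ 8 * Real.exp (-(L : ℝ) ^ (1 / 20 : ℝ)) ≤ (L : ℝ) ^ (-(1 / 100) : ℝ) := by
  filter_upwards [tendsto_natCast_atTop_atTop.eventually (eventually_mul_rpow_mul_exp_le
      (show (0 : ℝ) < 1 / 40 by norm_num) (show (1 / 40 : ℝ) < 1 / 20 by norm_num) one_pos 8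
      (1 / 100 + (8 : ℕ))),
    (tendsto_natCast_rpow (a := 49 / 100) (by norm_num)).eventually_ge_atTop 12,
    eventually_ge_atTop 1] with L hexp hpow hL
  have hL0 : (0 : ℝ) < L := by exact_mod_cast hL
  have hsqrt : 12 * (L : ℝ) ^ (-(1 / 2) : ℝ) ≤ (L : ℝ) ^ (-(1 / 100) : ℝ) :=
    calc 12 * (L : ℝ) ^ (-(1 / 2) : ℝ) ≤ (L : ℝ) ^ (49 / 100 : ℝ) * (L : ℝ) ^ (-(1 / 2) : ℝ) := by
          gcongr
      _ = (L : ℝ) ^ (-(1 / 100) : ℝ) := by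
          rw [← Real.rpow_add hL0]
          norm_num
  have hrate : 8 * (L : ℝ) ^ 8 * Real.exp (-(L : ℝ) ^ (1 / 20 : ℝ))
      ≤ (L : ℝ) ^ (-(1 / 100) : ℝ) := by
    rw [one_mul, Real.rpow_add hL0, Real.rpow_natCast] at hexp
    rw [Real.rpow_neg hL0.le, le_inv_comm₀ (by positivity) (by positivity), ← one_div,
      le_div_iff₀ (by positivity)]
    calc _ = 8 * ((L : ℝ) ^ (1 / 100 : ℝ) * (L : ℝ) ^ 8) * Real.exp (-(L : ℝ) ^ (1 / 20 : ℝ)) := by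
          ring
      _ ≤ Real.exp (-(L : ℝ) ^ (1 / 40 : ℝ)) := hexp
      _ ≤ 1 := Real.exp_le_one_iff.2 (neg_nonpos.2 (by positivity))
  linarith

end Mean

lemma eventually_mean_div_le :
    ∀ᶠ L : ℕ in atTop, ∀ N : ℕ, L ^ 2 ≤ N → N ≤ L ^ 4 → ∀ A A' : ℕ → Measure ℤ,
      IsWalkLaw A → IsWalkLaw A' → Refreshes A A' L →
        mean A N / N ≤ mean A' L / L + (L : ℝ) ^ (-(1 / 100) : ℝ) := by
  filter_upwards [eventually_mean_error_le, eventually_ge_atTop 1] with L herr hL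
    N hLN hNL A A' hA hA' h
  have hL1 : (1 : ℝ) ≤ L := by exact_mod_cast hL
  have hL0 : (0 : ℝ) < L := one_pos.trans_le hL1
  have hLN : (L : ℝ) ^ 2 ≤ N := by exact_mod_cast hLN
  have hNL : (N : ℝ) ≤ (L : ℝ) ^ 4 := by exact_mod_cast hNL
  have hN : 0 < (N : ℝ) := (pow_pos hL0 2).trans_le hLN
  have hsqrt : (Nat.sqrt L : ℝ) / L ≤ (L : ℝ) ^ (-(1 / 2) : ℝ) := by
    rw [div_le_iff₀ hL0, ← Real.rpow_add_one hL0.ne']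
    norm_num [← Real.sqrt_eq_rpow, Real.nat_sqrt_le_real_sqrt]
  have hdiv : (L : ℝ) / N ≤ (L : ℝ) ^ (-(1 / 2) : ℝ) :=
    calc (L : ℝ) / N ≤ L / L ^ 2 := by gcongr
      _ = (L : ℝ) ^ (-1 : ℝ) := by
          rw [Real.rpow_neg_one]
          field_simp
      _ ≤ (L : ℝ) ^ (-(1 / 2) : ℝ) := Real.rpow_le_rpow_of_exponent_le hL1 (by norm_num)
  have hrate : 2 * N * refreshRate N L ≤ 4 * (L : ℝ) ^ 8 * Real.exp (-(L : ℝ) ^ (1 / 20 : ℝ)) :=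
    calc 2 * N * refreshRate N L
        ≤ 2 * (L : ℝ) ^ 4 * ((L ^ 4 + L ^ 4) * Real.exp (-(L : ℝ) ^ (1 / 20 : ℝ))) := by
          unfold refreshRate
          gcongr
          exact one_le_pow₀ hL1
      _ = 4 * (L : ℝ) ^ 8 * Real.exp (-(L : ℝ) ^ (1 / 20 : ℝ)) := by ring
  calc mean A N / N
      ≤ (mean A' L / L * N + 2 * (2 * L + N * (Nat.sqrt L / L)) + N * (2 * N * refreshRate N L))
          / N := by
        gcongr
        exact h.mean_le_mul_add hA hA' hL N
    _ = mean A' L / L + 2 * (2 * (L / N) + Nat.sqrt L / L) + 2 * N * refreshRate N L := by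
        field_simp
    _ ≤ mean A' L / L + (L : ℝ) ^ (-(1 / 100) : ℝ) := by linarith

namespace Environment

variable {T : Type} [CommSemiring T] [LinearOrder T] {E : Environment T} {p₀ p₁ ν : ℝ}

lemma abs_meanSpeed_le {ρ : ℝ} (hρ : ρ ∈ E.J) (L : ℕ) : |E.meanSpeed p₀ p₁ ρ L| ≤ 1 := by
  rw [meanSpeed_eq, abs_div, Nat.abs_cast]
  exact div_le_one_of_le₀ ((isWalkLaw_walkLaw hρ).abs_mean_le L) (by positivity)

lemma eventually_meanSpeed_le_of_le_pow [IsStrictOrderedRing T] (hν : 0 < ν)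
    (hdrift : E.NoDriftingIn ν) (hcover : E.Covering ν) (hp : JumpRates p₀ p₁) :
    ∀ᶠ L : ℕ in atTop, ∀ ρ ∈ E.J, ∀ ρ' ∈ E.J, ρ' < ρ + 1 →
      ρ + (L : ℝ) ^ (-(1 / 100) : ℝ) ≤ ρ' → ∀ N : ℕ, L ^ 2 ≤ N → N ≤ L ^ 4 →
        E.meanSpeed p₀ p₁ ρ N ≤ E.meanSpeed p₀ p₁ ρ' L + (L : ℝ) ^ (-(1 / 100) : ℝ) := by
  filter_upwards [eventually_refreshes hν hdrift hcover hp, eventually_mean_div_le]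
    with L hrefresh hmean ρ hρ ρ' hρ' hlt hle N hLN hNL
  rw [meanSpeed_eq, meanSpeed_eq]
  exact hmean N hLN hNL _ _ (isWalkLaw_walkLaw hρ) (isWalkLaw_walkLaw hρ')
    (hrefresh ρ hρ ρ' hρ' hlt hle).1

/-- The scales are iterated along `L ↦ L ^ 2`; the densities spent on the way form a geometric
series. -/
lemma eventually_meanSpeed_le [IsStrictOrderedRing T] (hν : 0 < ν)
    (hdrift : E.NoDriftingIn ν) (hcover : E.Covering ν) (hp : JumpRates p₀ p₁) :
    ∀ᶠ L : ℕ in atTop, ∀ ρ ∈ E.J, ∀ ρ' ∈ E.J, ρ' < ρ + 1 →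
      ρ + 2 * (L : ℝ) ^ (-(1 / 100) : ℝ) ≤ ρ' → ∀ N : ℕ, L ^ 2 ≤ N →
        E.meanSpeed p₀ p₁ ρ N ≤ E.meanSpeed p₀ p₁ ρ' L + 2 * (L : ℝ) ^ (-(1 / 100) : ℝ) := by
  obtain ⟨L₀, hL₀⟩ := eventually_atTop.1 (eventually_meanSpeed_le_of_le_pow hν hdrift hcover hp)
  filter_upwards [eventually_ge_atTop (max 2 L₀)] with L hL ρ hρ ρ' hρ' hlt hle N hN
  induction hd : N - L using Nat.strong_induction_on generalizing L ρ' with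
  | h d ih =>
    have h2 : 2 ≤ L := (le_max_left _ _).trans hL
    have hLsq : L < L ^ 2 := lt_self_pow₀ (by omega) (by norm_num)
    have hstep := hL₀ L ((le_max_right _ _).trans hL)
    set e := (L : ℝ) ^ (-(1 / 100) : ℝ) with he
    have he0 : 0 < e := by positivity
    rcases le_total N (L ^ 4) with hN4 | hN4
    · linarith [hstep ρ hρ ρ' hρ' hlt (by linarith) N hN hN4]
    · have he2 : ((L ^ 2 : ℕ) : ℝ) ^ (-(1 / 100) : ℝ) = e ^ 2 := by
        rw [he, Nat.cast_pow, ← Real.rpow_natCast, ← Real.rpow_natCast, ← Real.rpow_mul,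
          ← Real.rpow_mul, mul_comm] <;> positivity
      have hesq : 2 * e ^ 2 ≤ e := by nlinarith
      have hmid : ρ + 2 * e ^ 2 ∈ E.J :=
        ordConnected_Ioo.out hρ hρ' ⟨le_add_of_nonneg_right (by positivity), by linarith⟩
      have hlarge := ih (N - L ^ 2) (by omega) (L ^ 2) (hL.trans hLsq.le) (ρ + 2 * e ^ 2) hmid
        (by linarith) (by rw [he2]) (by rwa [← pow_mul]) rfl
      have hsmall := hstep (ρ + 2 * e ^ 2) hmid ρ' hρ' (by nlinarith) (by linarith) (L ^ 2) le_rfl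
        (Nat.pow_le_pow_right (by omega) (by norm_num))
      rw [he2] at hlarge
      linarith

end Environment

/-! ### Deviation estimates by exponential moments -/

/-- The exponential moment of the position at time `n`, centred at speed `v`. -/
def expMoment (A : ℕ → Measure ℤ) (θ v : ℝ) (n : ℕ) : ℝ :=
  ∫ x, Real.exp (θ * (x - v * n)) ∂(A n)

/-- The exponential moment of the centred displacement over one block of length `√L + L`, whose
first `√L` steps are bounded by `√L`. -/
def blockMoment (A : ℕ → Measure ℤ) (θ v : ℝ) (L : ℕ) : ℝ :=
  ∫ y, Real.exp (θ * (y + Nat.sqrt L - v * (Nat.sqrt L + L))) ∂(A L)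

section ExpMoment

variable {A A' : ℕ → Measure ℤ} {L : ℕ} {θ κ v w : ℝ}

lemma measureReal_ge_le_expMoment (hA : IsWalkLaw A) (hθ : 0 ≤ θ) (v : ℝ) (n : ℕ) :
    (A n).real {x : ℤ | v * n ≤ x} ≤ expMoment A θ v n := by
  have := hA.prob n
  have hmarkov := mul_meas_ge_le_integral_of_nonneg (μ := A n)
    (f := fun x : ℤ => Real.exp (θ * (x - v * n)))
    (Eventually.of_forall fun _ => (Real.exp_pos _).le) (hA.integrable _ _) 1
  rw [one_mul] at hmarkov
  exact (measureReal_mono fun x hx =>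
    Real.one_le_exp (mul_nonneg hθ (sub_nonneg.2 hx))).trans hmarkov

lemma Refreshes.expMoment_le (h : Refreshes A A' L) (hθ : 0 ≤ θ) (v : ℝ) (n : ℕ) :
    expMoment A θ v (n + (Nat.sqrt L + L)) ≤ expMoment A θ v n * blockMoment A' θ v L
      + Real.exp (θ * (1 + |v|) * (n + (Nat.sqrt L + L) : ℕ)) * refreshRate n L := by
  set R : ℕ := n + (Nat.sqrt L + L) with hR
  have hle := h n (fun x => Real.exp (θ * (x - v * R))) fun x y hxy => by
    dsimp only
    gcongr
  have hfactor : ∫ x, ∫ y, Real.exp (θ * (((x + Nat.sqrt L + y : ℤ) : ℝ) - v * R)) ∂(A' L) ∂(A n)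
      = expMoment A θ v n * blockMoment A' θ v L := by
    rw [expMoment, ← integral_mul_const]
    simp only [blockMoment, ← integral_const_mul, ← Real.exp_add]
    congr! 5
    rw [hR]
    push_cast
    ring
  have hrange : Real.exp (θ * (((R : ℤ) : ℝ) - v * R))
      - Real.exp (θ * (((-(R : ℤ) : ℤ) : ℝ) - v * R))
        ≤ Real.exp (θ * (1 + |v|) * R) := by
    refine (sub_le_self _ (Real.exp_pos _).le).trans (Real.exp_le_exp.2 ?_)
    calc θ * (((R : ℤ) : ℝ) - v * R) = θ * (1 + -v) * R := by
          push_cast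
          ring
      _ ≤ θ * (1 + |v|) * R := by
          gcongr
          exact neg_le_abs v
  rw [hfactor] at hle
  have hrate := refreshRate_nonneg n L
  exact hle.trans (by gcongr)

lemma Refreshes.expMoment_iterate_le (h : Refreshes A A' L) (hθ : 0 ≤ θ) {q a : ℝ}
    (hq1 : q ≤ 1) (hq : blockMoment A' θ v L ≤ q) (r k N : ℕ) (ha : expMoment A θ v r ≤ a)
    (hN : r + k * (Nat.sqrt L + L) ≤ N) :
    expMoment A θ v (r + k * (Nat.sqrt L + L))
      ≤ q ^ k * a + k * (Real.exp (θ * (1 + |v|) * N) * refreshRate N L) := by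
  have : 0 ≤ q := (integral_nonneg fun _ => (Real.exp_pos _).le).trans hq
  induction k with
  | zero => simpa using ha
  | succ k ih =>
    set n := r + k * (Nat.sqrt L + L)
    have hsucc : r + (k + 1) * (Nat.sqrt L + L) = n + (Nat.sqrt L + L) := by ring
    rw [hsucc] at hN ⊢
    set G := Real.exp (θ * (1 + |v|) * N) * refreshRate N L
    have hG : 0 ≤ G := mul_nonneg (Real.exp_pos _).le (refreshRate_nonneg N L)
    have hmoment : 0 ≤ expMoment A θ v n := integral_nonneg fun _ => (Real.exp_pos _).le
    have herr : Real.exp (θ * (1 + |v|) * (n + (Nat.sqrt L + L) : ℕ)) * refreshRate n L ≤ G :=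
      mul_le_mul (by gcongr) (refreshRate_le (by omega) L) (refreshRate_nonneg n L)
        (Real.exp_pos _).le
    calc expMoment A θ v (n + (Nat.sqrt L + L))
        ≤ expMoment A θ v n * blockMoment A' θ v L + G :=
          (h.expMoment_le hθ v n).trans (add_le_add_right herr _)
      _ ≤ (q ^ k * a + k * G) * q + G := by
          exact add_le_add_left (mul_le_mul (ih (by omega)) hq
            (integral_nonneg fun _ => (Real.exp_pos _).le) (hmoment.trans (ih (by omega)))) _
      _ = q ^ (k + 1) * a + k * G * q + G := by ring
      _ ≤ q ^ (k + 1) * a + k * G * 1 + G := by gcongr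
      _ = q ^ (k + 1) * a + (k + 1 : ℕ) * G := by
          push_cast
          ring

lemma expMoment_le_exp_one (hA : IsWalkLaw A) (hκ : 0 ≤ κ) (hκv : κ * (2 + 2 * |v|) ≤ 1)
    (hL : 0 < L) {r : ℕ} (hr : r ≤ 2 * L) : expMoment A (κ / L) v r ≤ Real.exp 1 := by
  have := hA.prob r
  have : (0 : ℝ) < L := by exact_mod_cast hL
  have hr : (r : ℝ) ≤ 2 * L := by exact_mod_cast hr
  have hbound : ∀ᵐ x : ℤ ∂(A r), Real.exp (κ / L * (x - v * r)) ≤ Real.exp 1 := by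
    filter_upwards [hA.ae_abs_le r] with x hx
    have hx : (x : ℝ) ≤ r := by exact_mod_cast (abs_le.1 hx).2
    rw [Real.exp_le_exp]
    calc κ / L * (x - v * r) ≤ κ / L * ((1 + |v|) * r) := by
          gcongr
          linarith [mul_le_mul_of_nonneg_right (neg_le_abs v) (Nat.cast_nonneg (α := ℝ) r)]
      _ ≤ κ / L * ((1 + |v|) * (2 * L)) := by gcongr
      _ = κ * (2 + 2 * |v|) := by
          field_simp
      _ ≤ 1 := hκv
  calc expMoment A (κ / L) v r ≤ ∫ _, Real.exp 1 ∂(A r) :=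
        integral_mono_ae (hA.integrable _ _) (integrable_const _) hbound
    _ = Real.exp 1 := by simp

lemma Refreshes.expMoment_le_of_blockMoment_le (h : Refreshes A A' L) (hA : IsWalkLaw A)
    (hL : 0 < L) (hκ : 0 ≤ κ) (hκv : κ * (2 + 2 * |v|) ≤ 1) {c : ℝ} (hc : 0 ≤ c)
    (hblock : blockMoment A' (κ / L) v L ≤ Real.exp (-c)) (N : ℕ) :
    expMoment A (κ / L) v N ≤ Real.exp (-c) ^ (N / (Nat.sqrt L + L)) * Real.exp 1
      + N * (Real.exp (κ / L * (1 + |v|) * N) * refreshRate N L) := by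
  set t := Nat.sqrt L
  have htL : t ≤ L := Nat.sqrt_le_self L
  have hr : N % (t + L) < t + L := Nat.mod_lt _ (by omega)
  have hN : N % (t + L) + N / (t + L) * (t + L) = N := by
    rw [add_comm, mul_comm]
    exact Nat.div_add_mod N (t + L)
  have hle := h.expMoment_iterate_le (by positivity) (Real.exp_le_one_iff.2 (neg_nonpos.2 hc))
    hblock _ (N / (t + L)) N (expMoment_le_exp_one hA hκ hκv hL (by omega)) hN.le
  rw [hN] at hle
  have hrate := refreshRate_nonneg N L
  have hk : ((N / (t + L) : ℕ) : ℝ) ≤ N := by exact_mod_cast Nat.div_le_self _ _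
  exact hle.trans (by gcongr)

lemma abs_block_displacement_le (hL : 0 < L) (hκ : 0 ≤ κ) (v : ℝ) {y : ℝ} (hy : |y| ≤ L) :
    |κ / L * (y + Nat.sqrt L - v * (Nat.sqrt L + L))| ≤ κ * (2 + 2 * |v|) := by
  have : (0 : ℝ) < L := by exact_mod_cast hL
  have htL : (Nat.sqrt L : ℝ) ≤ L := by exact_mod_cast Nat.sqrt_le_self L
  set t : ℝ := (Nat.sqrt L : ℝ)
  have ht : 0 ≤ t := Nat.cast_nonneg _
  have hdispl : |y + t - v * (t + L)| ≤ L + L + |v| * (2 * L) :=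
    calc |y + t - v * (t + L)| ≤ |y| + |t| + |v * (t + L)| :=
          (abs_sub _ _).trans (add_le_add_left (abs_add_le _ _) _)
      _ = |y| + t + |v| * (t + L) := by
          rw [abs_mul, abs_of_nonneg ht, abs_of_nonneg (by positivity : 0 ≤ t + L)]
      _ ≤ L + L + |v| * (2 * L) := by
          gcongr
          linarith
  calc |κ / L * (y + t - v * (t + L))| = κ / L * |y + t - v * (t + L)| := by
        rw [abs_mul, abs_of_nonneg (by positivity)]
    _ ≤ κ / L * (L + L + |v| * (2 * L)) := by gcongr
    _ = κ * (2 + 2 * |v|) := by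
        field_simp
        ring

lemma blockMoment_le (hA : IsWalkLaw A) (hL : 0 < L) (hκ : 0 ≤ κ) (hκv : κ * (2 + 2 * |v|) ≤ 1) :
    blockMoment A (κ / L) v L ≤ 1 + κ / L * (mean A L + Nat.sqrt L - v * (Nat.sqrt L + L))
      + (κ * (2 + 2 * |v|)) ^ 2 := by
  have := hA.prob L
  set t : ℝ := (Nat.sqrt L : ℝ)
  set Y : ℤ → ℝ := fun y => κ / L * (y + t - v * (t + L)) with hY
  have hYbound : ∀ᵐ y ∂(A L), |Y y| ≤ κ * (2 + 2 * |v|) := by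
    filter_upwards [hA.ae_abs_le L] with y hy
    exact abs_block_displacement_le hL hκ v (by exact_mod_cast hy)
  have hYmean : ∫ y, Y y ∂(A L) = κ / L * (mean A L + t - v * (t + L)) := by
    rw [hY, integral_const_mul, integral_sub (hA.integrable _ _) (integrable_const _),
      integral_add (hA.integrable _ _) (integrable_const _)]
    simp [mean]
  calc ∫ y, Real.exp (Y y) ∂(A L) ≤ ∫ y, (1 + Y y + (κ * (2 + 2 * |v|)) ^ 2) ∂(A L) := by
        refine integral_mono_ae (hA.integrable _ _) (hA.integrable _ _) ?_
        filter_upwards [hYbound] with y hy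
        have hexp := (abs_le.1 (Real.abs_exp_sub_one_sub_id_le (hy.trans hκv))).2
        have hsq := sq_le_sq' (abs_le.1 hy).1 (abs_le.1 hy).2
        linarith
    _ = 1 + κ / L * (mean A L + t - v * (t + L)) + (κ * (2 + 2 * |v|)) ^ 2 := by
        rw [integral_add (hA.integrable _ _) (integrable_const _),
          integral_add (integrable_const _) (hA.integrable _ _), hYmean]
        simp

/-- Since `exp y ≤ 1 + y + y ^ 2` and the block has mean at most `-(v - w) L / 2`, a small `κ`
works. -/
lemma exists_eventually_blockMoment_le (hA : IsWalkLaw A) (hwv : w < v)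
    (hw : ∀ᶠ L : ℕ in atTop, mean A L ≤ w * L) :
    ∃ κ c : ℝ, 0 < κ ∧ 0 < c ∧ c ≤ 1 ∧ κ * (2 + 2 * |v|) ≤ 1 ∧
      ∀ᶠ L : ℕ in atTop, blockMoment A (κ / L) v L ≤ Real.exp (-c) := by
  set B := 2 + 2 * |v|
  have hB2 : 2 ≤ B := by linarith [abs_nonneg v]
  set g := min (v - w) 1
  have hg0 : 0 < g := lt_min (by linarith) one_pos
  have hg1 : g ≤ 1 := min_le_right _ _
  set κ := g / (4 * B ^ 2)
  have hκ0 : 0 < κ := by positivity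
  have hκB : κ * (4 * B ^ 2) = g := div_mul_cancel₀ _ (by positivity)
  have hκB1 : κ * B ≤ 1 := by nlinarith [mul_pos hκ0 (by linarith : (0 : ℝ) < B)]
  refine ⟨κ, κ * g / 4, hκ0, by positivity, by nlinarith, hκB1, ?_⟩
  filter_upwards [hw, eventually_gt_atTop 0, eventually_lt_mul_sqrt hg0 B] with L hw hL hsqrt
  have : (0 : ℝ) < L := by exact_mod_cast hL
  refine (blockMoment_le hA hL hκ0.le hκB1).trans ?_
  have htL : (Nat.sqrt L : ℝ) * Nat.sqrt L ≤ L := by exact_mod_cast Nat.sqrt_le L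
  set t : ℝ := (Nat.sqrt L : ℝ)
  have hBt : B * t ≤ g * L :=
    calc B * t ≤ g * t * t := by gcongr
      _ = g * (t * t) := by ring
      _ ≤ g * L := by gcongr
  have hdrift : mean A L + t - v * (t + L) ≤ -(g / 2 * L) := by
    have hvt : -v * t ≤ |v| * t := by
      gcongr
      exact neg_le_abs v
    have hgL : g * L ≤ (v - w) * L := by
      gcongr
      exact min_le_left _ _
    linarith
  calc 1 + κ / L * (mean A L + t - v * (t + L)) + (κ * B) ^ 2
      ≤ 1 + κ / L * -(g / 2 * L) + (κ * B) ^ 2 := by gcongr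
    _ = -(κ * g / 4) + 1 := by
        rw [← hκB]
        field_simp
        ring
    _ ≤ Real.exp (-(κ * g / 4)) := Real.add_one_le_exp _

end ExpMoment

/-! ### Stretched exponential tails -/

lemma eventually_expMoment_error_le {a : ℝ} (ha : 0 ≤ a) :
    ∀ᶠ p : ℕ in atTop, ∀ N : ℕ, N ≤ (2 * p) ^ 41 →
      N * (Real.exp (a / (p ^ 40 : ℕ) * N) * refreshRate N (p ^ 40)) ≤ Real.exp (-(p : ℝ)) := by
  set Z : ℝ := 2 ^ 41 with hZ
  filter_upwards [tendsto_natCast_atTop_atTop.eventually (eventually_mul_rpow_mul_exp_le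
      one_pos (show (1 : ℝ) < 2 by norm_num) one_half_pos (2 * Z ^ 2) (82 : ℕ)),
    tendsto_natCast_atTop_atTop.eventually_ge_atTop (2 * (a * Z)), eventually_gt_atTop 0]
    with p hexp hpa hp N hN
  have hp1 : (1 : ℝ) ≤ p := by exact_mod_cast hp
  have hN : (N : ℝ) ≤ Z * p ^ 41 := by
    rw [hZ, ← mul_pow]
    exact_mod_cast hN
  have hone : 1 ≤ Z * (p : ℝ) ^ 41 :=
    one_le_mul_of_one_le_of_one_le (by norm_num [hZ]) (one_le_pow₀ hp1)
  have hgrowth : a / (p ^ 40 : ℕ) * N ≤ (p : ℝ) ^ 2 / 2 :=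
    calc a / (p ^ 40 : ℕ) * N ≤ a / (p ^ 40 : ℕ) * (Z * p ^ 41) := by gcongr
      _ = 2 * (a * Z) * p / 2 := by
          push_cast
          field_simp
      _ ≤ p * p / 2 := by gcongr
      _ = (p : ℝ) ^ 2 / 2 := by ring
  have hscale : ((p ^ 40 : ℕ) : ℝ) ^ (1 / 20 : ℝ) = (p : ℝ) ^ 2 := by
    rw [Nat.cast_pow, ← Real.rpow_natCast, ← Real.rpow_mul (by positivity), ← Real.rpow_natCast]
    norm_num
  rw [Real.rpow_natCast, Real.rpow_one, Real.rpow_two] at hexp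
  calc N * (Real.exp (a / (p ^ 40 : ℕ) * N) * refreshRate N (p ^ 40))
      ≤ Z * p ^ 41 * (Real.exp ((p : ℝ) ^ 2 / 2)
          * ((Z * p ^ 41 + Z * p ^ 41) * Real.exp (-(p : ℝ) ^ 2))) := by
        rw [refreshRate, hscale]
        gcongr
    _ = 2 * Z ^ 2 * (p : ℝ) ^ 82 * (Real.exp ((p : ℝ) ^ 2 / 2) * Real.exp (-(p : ℝ) ^ 2)) := by
        ring
    _ = 2 * Z ^ 2 * (p : ℝ) ^ 82 * Real.exp (-(1 / 2 * (p : ℝ) ^ 2)) := by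
        rw [← Real.exp_add]
        ring_nf
    _ ≤ Real.exp (-(p : ℝ)) := hexp

lemma half_sub_one_le_div_block {p L N : ℕ} (hL : 0 < L) (hN : p * L ≤ N) :
    (p : ℝ) / 2 - 1 ≤ (N / (Nat.sqrt L + L) : ℕ) := by
  have htL : Nat.sqrt L ≤ L := Nat.sqrt_le_self L
  set S := Nat.sqrt L + L
  have hlt : p * L < 2 * (N / S + 1) * L :=
    calc p * L ≤ N := hN
      _ < S * (N / S + 1) := Nat.lt_mul_div_succ N (by omega)
      _ ≤ 2 * L * (N / S + 1) := Nat.mul_le_mul_right _ (by omega)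
      _ = 2 * (N / S + 1) * L := by ring
  have hp : (p : ℝ) < 2 * ((N / S : ℕ) + 1) := by
    exact_mod_cast Nat.lt_of_mul_lt_mul_right hlt
  linarith

section Tails

variable {A A' : ℕ → Measure ℤ} {v w : ℝ}

/-- At a time of order `p ^ 41` there are of order `p` blocks of length of order `p ^ 40`. -/
lemma exists_measureReal_ge_le (hA : IsWalkLaw A) (hA' : IsWalkLaw A')
    (hR : ∀ᶠ L : ℕ in atTop, Refreshes A A' L) (hwv : w < v)
    (hw : ∀ᶠ L : ℕ in atTop, mean A' L ≤ w * L) :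
    ∃ c D : ℝ, 0 < c ∧ ∀ᶠ p : ℕ in atTop, ∀ N : ℕ, p ^ 41 ≤ N → N ≤ (2 * p) ^ 41 →
      (A N).real {x : ℤ | v * N ≤ x} ≤ D * Real.exp (-(c * p)) := by
  obtain ⟨κ, c, hκ, hc, hc1, hκv, hblock⟩ := exists_eventually_blockMoment_le hA' hwv hw
  have hscale : Tendsto (fun p : ℕ => p ^ 40) atTop atTop := tendsto_pow_atTop (by norm_num)
  refine ⟨c / 2, Real.exp 2 + 1, by positivity, ?_⟩
  filter_upwards [hscale.eventually (hR.and hblock), eventually_gt_atTop 0,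
    eventually_expMoment_error_le (a := κ * (1 + |v|)) (by positivity)]
    with p ⟨hRp, hblock⟩ hp herr N hpN hNp
  have hL : 0 < p ^ 40 := Nat.pow_pos hp
  have hblocks := half_sub_one_le_div_block hL ((pow_succ' p 40).ge.trans hpN)
  have hrest : N * (Real.exp (κ / (p ^ 40 : ℕ) * (1 + |v|) * N) * refreshRate N (p ^ 40))
      ≤ Real.exp (-(c / 2 * p)) := by
    rw [div_mul_eq_mul_div]
    refine (herr N hNp).trans (Real.exp_le_exp.2 (neg_le_neg ?_))
    exact mul_le_of_le_one_left (Nat.cast_nonneg p) (by linarith)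
  calc (A N).real {x : ℤ | v * N ≤ x} ≤ expMoment A (κ / (p ^ 40 : ℕ)) v N :=
        measureReal_ge_le_expMoment hA (by positivity) v N
    _ ≤ Real.exp (-c) ^ (N / (Nat.sqrt (p ^ 40) + p ^ 40)) * Real.exp 1
          + N * (Real.exp (κ / (p ^ 40 : ℕ) * (1 + |v|) * N) * refreshRate N (p ^ 40)) :=
        hRp.expMoment_le_of_blockMoment_le hA hL hκ.le hκv hc.le hblock N
    _ ≤ Real.exp 2 * Real.exp (-(c / 2 * p)) + Real.exp (-(c / 2 * p)) := by
        refine add_le_add ?_ hrest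
        rw [← Real.exp_nat_mul, ← Real.exp_add, ← Real.exp_add, Real.exp_le_exp]
        linarith [mul_le_mul_of_nonneg_left hblocks hc.le]
    _ = (Real.exp 2 + 1) * Real.exp (-(c / 2 * p)) := by ring

lemma eventually_mul_exp_rpow_le_inv_sq {c : ℝ} (hc : 0 < c) (D : ℝ) :
    ∀ᶠ N : ℕ in atTop, D * Real.exp (-(c * (N : ℝ) ^ (1 / 41 : ℝ)))
      ≤ Real.exp (-(N : ℝ) ^ (1 / 82 : ℝ)) * (((N : ℝ) + 1) ^ 2)⁻¹ := by
  filter_upwards [tendsto_natCast_atTop_atTop.eventually (eventually_mul_rpow_mul_exp_le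
    (show (0 : ℝ) < 1 / 82 by norm_num) (show (1 / 82 : ℝ) < 1 / 41 by norm_num) hc (4 * |D|)
    (2 : ℕ)), eventually_ge_atTop 1] with N h hN
  have hN1 : (1 : ℝ) ≤ N := by exact_mod_cast hN
  rw [← div_eq_mul_inv, le_div_iff₀ (by positivity)]
  refine le_trans ?_ h
  rw [Real.rpow_natCast]
  calc D * Real.exp (-(c * (N : ℝ) ^ (1 / 41 : ℝ))) * ((N : ℝ) + 1) ^ 2
      ≤ |D| * Real.exp (-(c * (N : ℝ) ^ (1 / 41 : ℝ))) * ((N : ℝ) + N) ^ 2 := by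
        gcongr
        exact le_abs_self D
    _ = 4 * |D| * (N : ℝ) ^ 2 * Real.exp (-(c * (N : ℝ) ^ (1 / 41 : ℝ))) := by ring

lemma eventually_le_mul_exp_rpow_inv {q : ℕ} (hq : q ≠ 0) {P : ℕ → ℝ} {c D : ℝ} (hc : 0 ≤ c)
    (h : ∀ᶠ p : ℕ in atTop, ∀ N : ℕ, p ^ q ≤ N → N ≤ (2 * p) ^ q →
      P N ≤ D * Real.exp (-(c * p))) :
    ∀ᶠ N : ℕ in atTop, P N ≤ |D| * Real.exp (-(c / 2 * (N : ℝ) ^ (1 / q : ℝ))) := by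
  obtain ⟨p₀, hp₀⟩ := eventually_atTop.1 h
  filter_upwards [eventually_ge_atTop ((p₀ + 1) ^ q)] with N hN
  obtain ⟨p, hpN, hNp⟩ : ∃ p : ℕ, p ^ q ≤ N ∧ N < (p + 1) ^ q :=
    ⟨Nat.nthRoot q N, Nat.pow_nthRoot_le (Or.inl hq), Nat.lt_pow_nthRoot_add_one hq N⟩
  have hp : p₀ + 1 ≤ p :=
    Nat.lt_succ_iff.1 (lt_of_pow_lt_pow_left₀ q (Nat.zero_le _) (hN.trans_lt hNp))
  have hNp2 : N ≤ (2 * p) ^ q := hNp.le.trans (Nat.pow_le_pow_left (by omega) q)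
  have hroot : (N : ℝ) ^ (1 / q : ℝ) ≤ 2 * p := by
    rw [one_div, Real.rpow_inv_le_iff_of_pos (Nat.cast_nonneg N) (by positivity)
      (by exact_mod_cast hq.bot_lt), Real.rpow_natCast]
    exact_mod_cast hNp2
  calc P N ≤ D * Real.exp (-(c * p)) := hp₀ p (by omega) N hpN hNp2
    _ ≤ |D| * Real.exp (-(c / 2 * (N : ℝ) ^ (1 / q : ℝ))) := by
        refine mul_le_mul (le_abs_self D) (Real.exp_le_exp.2 (neg_le_neg ?_))
          (Real.exp_pos _).le (abs_nonneg D)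
        linarith [mul_le_mul_of_nonneg_left hroot hc]

lemma eventually_exp_div_rpow_mul_le {B : ℝ} (hB : 0 < B) (D : ℝ) :
    ∀ᶠ K : ℕ in atTop, Real.exp (-(K / B : ℝ) ^ (1 / 82 : ℝ)) * D
      ≤ Real.exp (-(K : ℝ) ^ (1 / 1000 : ℝ)) := by
  filter_upwards [tendsto_natCast_atTop_atTop.eventually (eventually_mul_rpow_mul_exp_le
    (show (0 : ℝ) < 1 / 1000 by norm_num) (show (1 / 1000 : ℝ) < 1 / 82 by norm_num)
    (show 0 < (B ^ (1 / 82 : ℝ))⁻¹ by positivity) D 0)] with K h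
  rwa [Real.rpow_zero, mul_one, inv_mul_eq_div, ← Real.div_rpow (Nat.cast_nonneg K) hB.le,
    mul_comm] at h

lemma measureReal_iUnion_le_tsum {Ω : Type*} [MeasurableSpace Ω] {m : Measure Ω}
    [IsFiniteMeasure m] {s : ℕ → Set Ω} {f : ℕ → ℝ} (hf : Summable f)
    (h : ∀ n, m.real (s n) ≤ f n) : m.real (⋃ n, s n) ≤ ∑' n, f n := by
  have hf0 : ∀ n, 0 ≤ f n := fun n => measureReal_nonneg.trans (h n)
  refine ENNReal.toReal_le_of_le_ofReal (tsum_nonneg hf0) ?_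
  rw [ENNReal.ofReal_tsum_of_nonneg hf0 hf]
  refine (measure_iUnion_le s).trans (ENNReal.tsum_le_tsum fun n => ?_)
  rw [← ofReal_measureReal]
  exact ENNReal.ofReal_le_ofReal (h n)

variable {Ω : Type*} [MeasurableSpace Ω] {m : Measure Ω} [IsProbabilityMeasure m]
  {X : ℕ → Ω → ℤ}

lemma eventually_measureReal_exists_lt_le (hXn : ∀ n ω, |X n ω| ≤ (n : ℤ))
    (h : ∀ᶠ n : ℕ in atTop, m.real {ω | v * n ≤ X n ω}
      ≤ Real.exp (-(n : ℝ) ^ (1 / 82 : ℝ)) * (((n : ℝ) + 1) ^ 2)⁻¹) :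
    ∀ᶠ K : ℕ in atTop, m.real {ω | ∃ n : ℕ, (n * v + K : ℝ) < X n ω}
      ≤ Real.exp (-(K : ℝ) ^ (1 / 1000 : ℝ)) := by
  obtain ⟨N₀, hN₀⟩ := eventually_atTop.1 h
  set B := 1 + |v| with hB
  have hB0 : 0 < B := by positivity
  have hsum : Summable fun n : ℕ => (((n : ℝ) + 1) ^ 2)⁻¹ := by
    simpa using (summable_nat_add_iff 1).2 (Real.summable_nat_pow_inv.2 one_lt_two)
  filter_upwards [eventually_exp_div_rpow_mul_le hB0 (∑' n : ℕ, (((n : ℝ) + 1) ^ 2)⁻¹),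
    tendsto_natCast_atTop_atTop.eventually_ge_atTop (N₀ * B)] with K hexp hK
  refine le_trans ?_ hexp
  rw [ofPred_exists, ← tsum_mul_left]
  refine measureReal_iUnion_le_tsum (hsum.mul_left _) fun n => ?_
  rcases le_or_gt ((n : ℝ) * B) K with hn | hn
  · have hempty : {ω | (n * v + K : ℝ) < X n ω} = ∅ := by
      refine eq_empty_of_forall_notMem fun ω hω => not_le_of_gt (mem_ofPred_eq ▸ hω) ?_
      have hXω : (X n ω : ℝ) ≤ n := by exact_mod_cast (abs_le.1 (hXn n ω)).2
      have hnv : (n : ℝ) * -|v| ≤ n * v := by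
        gcongr
        exact neg_abs_le v
      rw [hB] at hn
      linarith
    rw [hempty, measureReal_empty]
    positivity
  · have hNn : N₀ ≤ n := by exact_mod_cast le_of_mul_le_mul_right (hK.trans hn.le) hB0
    calc m.real {ω | (n * v + K : ℝ) < X n ω} ≤ m.real {ω | v * n ≤ X n ω} :=
          measureReal_mono fun ω hω => by
            have hω : (n * v + K : ℝ) < X n ω := hω
            change v * n ≤ X n ω
            linarith [Nat.cast_nonneg (α := ℝ) K]
      _ ≤ Real.exp (-(n : ℝ) ^ (1 / 82 : ℝ)) * (((n : ℝ) + 1) ^ 2)⁻¹ := hN₀ n hNn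
      _ ≤ Real.exp (-(K / B : ℝ) ^ (1 / 82 : ℝ)) * (((n : ℝ) + 1) ^ 2)⁻¹ := by
          gcongr
          exact (div_le_iff₀ hB0).2 hn.le

lemma eventually_measureReal_exists_lt_le_of_refreshes (hX : ∀ n, Measurable (X n))
    (hXn : ∀ n ω, |X n ω| ≤ (n : ℤ)) (hAX : ∀ n, A n = m.map (X n)) (hA' : IsWalkLaw A')
    (hR : ∀ᶠ L : ℕ in atTop, Refreshes A A' L) (hwv : w < v)
    (hw : ∀ᶠ L : ℕ in atTop, mean A' L ≤ w * L) :
    ∀ᶠ K : ℕ in atTop, m.real {ω | ∃ n : ℕ, (n * v + K : ℝ) < X n ω}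
      ≤ Real.exp (-(K : ℝ) ^ (1 / 1000 : ℝ)) := by
  have hA : IsWalkLaw A :=
    { prob := fun n => hAX n ▸ Measure.isProbabilityMeasure_map (hX n).aemeasurable
      ae_abs_le := fun n => by
        rw [hAX, ae_map_iff (hX n).aemeasurable .of_discrete]
        exact ae_of_all _ (hXn n) }
  obtain ⟨c, D, hc, hdev⟩ := exists_measureReal_ge_le hA hA' hR hwv hw
  refine eventually_measureReal_exists_lt_le hXn ?_
  filter_upwards [eventually_le_mul_exp_rpow_inv (by norm_num) hc.le hdev,
    eventually_mul_exp_rpow_le_inv_sq (half_pos hc) |D|] with n hn hexp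
  rw [hAX, map_measureReal_apply (hX n) .of_discrete] at hn
  exact hn.trans hexp

end Tails

namespace Environment

variable {T : Type} [CommSemiring T] [LinearOrder T] {E : Environment T} {p₀ p₁ ν ρ : ℝ}

/-! ### Existence of the speeds -/

lemma eventually_rpow_neg_le {ε : ℝ} (hε : 0 < ε) :
    ∀ᶠ L : ℕ in atTop, (L : ℝ) ^ (-(1 / 100) : ℝ) ≤ ε :=
  ((tendsto_rpow_neg_atTop (by norm_num)).comp tendsto_natCast_atTop_atTop).eventually_le_const hε

lemma isBoundedUnder_le_meanSpeed (hρ : ρ ∈ E.J) :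
    IsBoundedUnder (· ≤ ·) atTop (E.meanSpeed p₀ p₁ ρ) :=
  isBoundedUnder_of ⟨1, fun L => (abs_le.1 (abs_meanSpeed_le hρ L)).2⟩

lemma isBoundedUnder_ge_meanSpeed (hρ : ρ ∈ E.J) :
    IsBoundedUnder (· ≥ ·) atTop (E.meanSpeed p₀ p₁ ρ) :=
  isBoundedUnder_of ⟨-1, fun L => (abs_le.1 (abs_meanSpeed_le hρ L)).1⟩

/-- The lower limit of the mean speeds, which unlike `speed` is meaningful at every density of
`E.J`; it is monotone and agrees with `speed` at the regular densities. -/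
def liminfSpeed (E : Environment T) (p₀ p₁ ρ : ℝ) : ℝ := liminf (E.meanSpeed p₀ p₁ ρ) atTop

lemma abs_liminfSpeed_le (hρ : ρ ∈ E.J) : |E.liminfSpeed p₀ p₁ ρ| ≤ 1 := by
  refine abs_le.2 ⟨?_, ?_⟩
  · exact le_liminf_of_le (isBoundedUnder_le_meanSpeed hρ).isCoboundedUnder_ge
      (Eventually.of_forall fun L => (abs_le.1 (abs_meanSpeed_le hρ L)).1)
  · refine liminf_le_of_le (isBoundedUnder_ge_meanSpeed hρ) fun b hb => ?_
    obtain ⟨L, hL⟩ := hb.exists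
    exact hL.trans (abs_le.1 (abs_meanSpeed_le hρ L)).2

/-- The upper limit of the mean speeds at a density is at most their lower limit at any larger
density, provided that the densities differ by less than one. -/
def SpeedsOrdered (E : Environment T) (p₀ p₁ : ℝ) : Prop :=
  ∀ ρ ∈ E.J, ∀ ρ' ∈ E.J, ρ < ρ' → ρ' < ρ + 1 →
    limsup (E.meanSpeed p₀ p₁ ρ) atTop ≤ E.liminfSpeed p₀ p₁ ρ'

lemma speedsOrdered [IsStrictOrderedRing T] (hν : 0 < ν) (hdrift : E.NoDriftingIn ν)
    (hcover : E.Covering ν) (hp : JumpRates p₀ p₁) : E.SpeedsOrdered p₀ p₁ := by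
  intro ρ hρ ρ' hρ' hlt hlt1
  refine le_of_forall_pos_sub_le fun δ hδ => ?_
  refine le_liminf_of_le (isBoundedUnder_le_meanSpeed hρ').isCoboundedUnder_ge ?_
  filter_upwards [eventually_meanSpeed_le hν hdrift hcover hp,
    eventually_rpow_neg_le (half_pos (lt_min hδ (sub_pos.2 hlt)))] with L hspeed hL
  have hgap : 2 * (L : ℝ) ^ (-(1 / 100) : ℝ) ≤ min δ (ρ' - ρ) := by linarith
  have hδL : 2 * (L : ℝ) ^ (-(1 / 100) : ℝ) ≤ δ := hgap.trans (min_le_left _ _)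
  have hρL : 2 * (L : ℝ) ^ (-(1 / 100) : ℝ) ≤ ρ' - ρ := hgap.trans (min_le_right _ _)
  rw [sub_le_iff_le_add]
  refine limsup_le_of_le (isBoundedUnder_ge_meanSpeed hρ).isCoboundedUnder_le ?_
  filter_upwards [eventually_ge_atTop (L ^ 2)] with N hN
  linarith [hspeed ρ hρ ρ' hρ' hlt1 (by linarith) N hN]

lemma speed_eq_liminfSpeed (hρ : ρ ∈ E.regularDensities p₀ p₁) :
    E.speed p₀ p₁ ρ = E.liminfSpeed p₀ p₁ ρ := by
  obtain ⟨-, v, hv⟩ := hρ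
  rw [speed, liminfSpeed, hv.limUnder_eq, hv.liminf_eq]

lemma tendsto_meanSpeed (hρ : ρ ∈ E.regularDensities p₀ p₁) :
    Tendsto (E.meanSpeed p₀ p₁ ρ) atTop (𝓝 (E.speed p₀ p₁ ρ)) :=
  tendsto_nhds_limUnder hρ.2

lemma SpeedsOrdered.monotoneOn (h : E.SpeedsOrdered p₀ p₁) {s : Set ℝ} (hs : s ⊆ E.J)
    (hs1 : ∀ x ∈ s, ∀ y ∈ s, y < x + 1) : MonotoneOn (E.liminfSpeed p₀ p₁) s := by
  intro x hx y hy hxy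
  rcases hxy.eq_or_lt with rfl | hlt
  · exact le_rfl
  · exact (liminf_le_limsup (isBoundedUnder_le_meanSpeed (hs hx))
      (isBoundedUnder_ge_meanSpeed (hs hx))).trans (h x (hs hx) y (hs hy) hlt (hs1 x hx y hy))

lemma SpeedsOrdered.mem_regularDensities_of_continuousAt (h : E.SpeedsOrdered p₀ p₁)
    (hρ : ρ ∈ E.J) (hcont : ContinuousAt (E.liminfSpeed p₀ p₁) ρ) :
    ρ ∈ E.regularDensities p₀ p₁ := by
  refine ⟨hρ, E.liminfSpeed p₀ p₁ ρ, tendsto_of_le_liminf_of_limsup_le le_rfl ?_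
    (isBoundedUnder_le_meanSpeed hρ) (isBoundedUnder_ge_meanSpeed hρ)⟩
  refine ge_of_tendsto (hcont.tendsto.mono_left (nhdsWithin_le_nhds (s := Ioi ρ))) ?_
  filter_upwards [Ioo_mem_nhdsGT hρ.2, Ioo_mem_nhdsGT (lt_add_one ρ)] with y hy hy1
  exact h ρ hρ y ⟨hρ.1.trans hy.1, hy.2⟩ hy.1 hy1.2

lemma SpeedsOrdered.exists_regular_between (h : E.SpeedsOrdered p₀ p₁) {a b : ℝ} (hab : a < b)
    (hs : Ioo a b ⊆ E.J) (hba : b < a + 1) : ∃ x ∈ E.regularDensities p₀ p₁, a < x ∧ x < b := by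
  have hmono : MonotoneOn (E.liminfSpeed p₀ p₁) (Ioo a b) :=
    h.monotoneOn hs fun x hx y hy => by linarith [hx.1, hy.2]
  obtain ⟨x, hx, hxab⟩ :=
    (hmono.countable_not_continuousWithinAt.dense_compl ℝ).exists_between hab
  have hcont : ContinuousWithinAt (E.liminfSpeed p₀ p₁) (Ioo a b) x := by
    by_contra hdisc
    exact hx ⟨hxab, hdisc⟩
  exact ⟨x, h.mem_regularDensities_of_continuousAt (hs hxab)
    (hcont.continuousAt (Ioo_mem_nhds hxab.1 hxab.2)), hxab⟩

lemma SpeedsOrdered.exists_isLowerSpeed (h : E.SpeedsOrdered p₀ p₁) (hρ : ρ ∈ E.J) :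
    ∃ v, E.IsLowerSpeed p₀ p₁ ρ v := by
  set a := max E.lo (ρ - 1 / 2)
  have haρ : a < ρ := max_lt hρ.1 (by linarith)
  have hρa : ρ - 1 / 2 ≤ a := le_max_right _ _
  have hJ : Ioo a ρ ⊆ E.J := fun x hx => ⟨(le_max_left _ _).trans_lt hx.1, hx.2.trans hρ.2⟩
  have hmono : MonotoneOn (E.liminfSpeed p₀ p₁) (Ioo a ρ) :=
    h.monotoneOn hJ fun x hx y hy => by linarith [hx.1, hy.2]
  have hbdd : BddAbove (E.liminfSpeed p₀ p₁ '' Ioo a ρ) :=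
    ⟨1, forall_mem_image.2 fun x hx => (abs_le.1 (abs_liminfSpeed_le (hJ hx))).2⟩
  have hlim := hmono.tendsto_nhdsWithin_Ioo_left (nonempty_Ioo.2 haρ) hbdd
  refine ⟨sSup (E.liminfSpeed p₀ p₁ '' Ioo a ρ), mem_closure_iff_nhdsWithin_neBot.1 ?_, ?_⟩
  · refine Metric.mem_closure_iff.2 fun δ hδ => ?_
    obtain ⟨x, hx, hax, hxρ⟩ := h.exists_regular_between (max_lt haρ (sub_lt_self ρ hδ))
      (fun x hx => hJ ⟨(le_max_left _ _).trans_lt hx.1, hx.2⟩)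
      (by linarith [le_max_left a (ρ - δ)])
    refine ⟨x, ⟨hx, hxρ⟩, ?_⟩
    rw [Real.dist_eq, abs_of_pos (sub_pos.2 hxρ)]
    linarith [le_max_right a (ρ - δ)]
  · refine (hlim.mono_left (nhdsWithin_mono _ inter_subset_right)).congr' ?_
    filter_upwards [self_mem_nhdsWithin] with x hx
    exact (speed_eq_liminfSpeed hx.1).symm

lemma SpeedsOrdered.exists_isUpperSpeed (h : E.SpeedsOrdered p₀ p₁) (hρ : ρ ∈ E.J) :
    ∃ v, E.IsUpperSpeed p₀ p₁ ρ v := by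
  set b := min E.hi (ρ + 1 / 2)
  have hρb : ρ < b := lt_min hρ.2 (by linarith)
  have hbρ : b ≤ ρ + 1 / 2 := min_le_right _ _
  have hJ : Ioo ρ b ⊆ E.J := fun x hx => ⟨hρ.1.trans hx.1, hx.2.trans_le (min_le_left _ _)⟩
  have hmono : MonotoneOn (E.liminfSpeed p₀ p₁) (Ioo ρ b) :=
    h.monotoneOn hJ fun x hx y hy => by linarith [hx.1, hy.2]
  have hbdd : BddBelow (E.liminfSpeed p₀ p₁ '' Ioo ρ b) :=
    ⟨-1, forall_mem_image.2 fun x hx => (abs_le.1 (abs_liminfSpeed_le (hJ hx))).1⟩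
  have hlim := hmono.tendsto_nhdsWithin_Ioo_right (nonempty_Ioo.2 hρb) hbdd
  refine ⟨sInf (E.liminfSpeed p₀ p₁ '' Ioo ρ b), mem_closure_iff_nhdsWithin_neBot.1 ?_, ?_⟩
  · refine Metric.mem_closure_iff.2 fun δ hδ => ?_
    obtain ⟨x, hx, hρx, hxb⟩ := h.exists_regular_between (lt_min hρb (lt_add_of_pos_right ρ hδ))
      (fun x hx => hJ ⟨hx.1, hx.2.trans_le (min_le_left _ _)⟩)
      (by linarith [min_le_left b (ρ + δ)])
    refine ⟨x, ⟨hx, hρx⟩, ?_⟩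
    rw [dist_comm, Real.dist_eq, abs_of_pos (sub_pos.2 hρx)]
    linarith [min_le_right b (ρ + δ)]
  · refine (hlim.mono_left (nhdsWithin_mono _ inter_subset_right)).congr' ?_
    filter_upwards [self_mem_nhdsWithin] with x hx
    exact (speed_eq_liminfSpeed hx.1).symm

/-! ### Deviations of the walk -/

lemma eventually_mean_le_of_speed_lt {w : ℝ} (hρ : ρ ∈ E.regularDensities p₀ p₁)
    (hw : E.speed p₀ p₁ ρ < w) : ∀ᶠ L : ℕ in atTop, mean (E.walkLaw p₀ p₁ ρ) L ≤ w * L := by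
  filter_upwards [(tendsto_meanSpeed hρ).eventually_lt_const hw, eventually_gt_atTop 0] with L h hL
  rw [meanSpeed_eq, div_lt_iff₀ (Nat.cast_pos.2 hL)] at h
  exact h.le

lemma eventually_mean_reflect_le_of_lt_speed {w : ℝ} (hρ : ρ ∈ E.regularDensities p₀ p₁)
    (hw : w < E.speed p₀ p₁ ρ) :
    ∀ᶠ L : ℕ in atTop, mean (reflect (E.walkLaw p₀ p₁ ρ)) L ≤ -w * L := by
  filter_upwards [(tendsto_meanSpeed hρ).eventually_const_lt hw, eventually_gt_atTop 0] with L h hL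
  rw [meanSpeed_eq, lt_div_iff₀ (Nat.cast_pos.2 hL)] at h
  rw [mean_reflect, neg_mul]
  exact neg_le_neg h.le

lemma IsLowerSpeed.exists_lt_speed {v v' : ℝ} (h : E.IsLowerSpeed p₀ p₁ ρ v') (hv : v < v') :
    ∃ ρ' ∈ E.regularDensities p₀ p₁, ρ' < ρ ∧ ρ < ρ' + 1 ∧ v < E.speed p₀ p₁ ρ' := by
  have := h.1
  obtain ⟨ρ', ⟨hspeed, hρ'⟩, hnear⟩ := (((h.2.eventually_const_lt hv).and
    self_mem_nhdsWithin).and (nhdsWithin_le_nhds (Ioi_mem_nhds (sub_one_lt ρ)))).exists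
  exact ⟨ρ', hρ'.1, hρ'.2, sub_lt_iff_lt_add.1 hnear, hspeed⟩

lemma IsUpperSpeed.exists_speed_lt {v v' : ℝ} (h : E.IsUpperSpeed p₀ p₁ ρ v') (hv : v' < v) :
    ∃ ρ' ∈ E.regularDensities p₀ p₁, ρ < ρ' ∧ ρ' < ρ + 1 ∧ E.speed p₀ p₁ ρ' < v := by
  have := h.1
  obtain ⟨ρ', ⟨hspeed, hρ'⟩, hnear⟩ := (((h.2.eventually_lt_const hv).and
    self_mem_nhdsWithin).and (nhdsWithin_le_nhds (Iio_mem_nhds (lt_add_one ρ)))).exists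
  exact ⟨ρ', hρ'.1, hρ'.2, hnear, hspeed⟩

variable [IsStrictOrderedRing T]

lemma IsLowerSpeed.eventually_measureReal_exists_walk_lt_le {v v' : ℝ}
    (h : E.IsLowerSpeed p₀ p₁ ρ v') (hν : 0 < ν) (hdrift : E.NoDriftingIn ν)
    (hcover : E.Covering ν) (hp : JumpRates p₀ p₁) (hρ : ρ ∈ E.J) (hv : v < v') :
    ∀ᶠ K : ℕ in atTop,
      (E.annealed ρ).real {ω | ∃ n : ℕ, (walk p₀ p₁ ω.1 ω.2 n : ℝ) < n * v - K}
        ≤ Real.exp (-(K : ℝ) ^ (1 / 1000 : ℝ)) := by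
  obtain ⟨ρ', hρ', hlt, hlt1, hspeed⟩ := h.exists_lt_speed hv
  obtain ⟨w, hvw, hw⟩ := exists_between hspeed
  have hrefresh : ∀ᶠ L : ℕ in atTop,
      Refreshes (reflect (E.walkLaw p₀ p₁ ρ)) (reflect (E.walkLaw p₀ p₁ ρ')) L := by
    filter_upwards [eventually_refreshes hν hdrift hcover hp,
      eventually_rpow_neg_le (sub_pos.2 hlt)] with L hL hgap
    exact (hL ρ' hρ'.1 ρ hρ hlt1 (by linarith)).2
  have hlaw (n : ℕ) : reflect (E.walkLaw p₀ p₁ ρ) n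
      = (E.annealed ρ).map fun ω => -walk p₀ p₁ ω.1 ω.2 n := by
    rw [reflect, walkLaw, Measure.map_map (measurable_of_countable _) (measurable_walk n)]
    rfl
  have := E.isProbabilityMeasure_annealed hρ
  filter_upwards [eventually_measureReal_exists_lt_le_of_refreshes
    (fun n => (measurable_walk n).neg) (fun n ω => (abs_neg _).trans_le (abs_walk_le _ _ n)) hlaw
    (isWalkLaw_walkLaw hρ'.1).reflect hrefresh (neg_lt_neg hvw)
    (eventually_mean_reflect_le_of_lt_speed hρ' hw)] with K hK
  refine (measureReal_mono ?_).trans hK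
  rintro ω ⟨n, hn⟩
  refine ⟨n, ?_⟩
  rw [Pi.neg_apply, Int.cast_neg]
  linarith

lemma IsUpperSpeed.eventually_measureReal_exists_lt_walk_le {v v' : ℝ}
    (h : E.IsUpperSpeed p₀ p₁ ρ v') (hν : 0 < ν) (hdrift : E.NoDriftingIn ν)
    (hcover : E.Covering ν) (hp : JumpRates p₀ p₁) (hρ : ρ ∈ E.J) (hv : v' < v) :
    ∀ᶠ K : ℕ in atTop,
      (E.annealed ρ).real {ω | ∃ n : ℕ, (n * v + K : ℝ) < walk p₀ p₁ ω.1 ω.2 n}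
        ≤ Real.exp (-(K : ℝ) ^ (1 / 1000 : ℝ)) := by
  obtain ⟨ρ', hρ', hlt, hlt1, hspeed⟩ := h.exists_speed_lt hv
  obtain ⟨w, hw, hwv⟩ := exists_between hspeed
  have hrefresh : ∀ᶠ L : ℕ in atTop,
      Refreshes (E.walkLaw p₀ p₁ ρ) (E.walkLaw p₀ p₁ ρ') L := by
    filter_upwards [eventually_refreshes hν hdrift hcover hp,
      eventually_rpow_neg_le (sub_pos.2 hlt)] with L hL hgap
    exact (hL ρ hρ ρ' hρ'.1 hlt1 (by linarith)).1
  have := E.isProbabilityMeasure_annealed hρ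
  exact eventually_measureReal_exists_lt_le_of_refreshes (fun n => measurable_walk n)
    (fun n ω => abs_walk_le _ _ n) (fun n => rfl) (isWalkLaw_walkLaw hρ'.1) hrefresh hwv
    (eventually_mean_le_of_speed_lt hρ' hw)

end Environment

lemma exists_le_two_mul_exp {P : ℕ → ℝ} {r : ℝ}
    (h : ∀ᶠ K : ℕ in atTop, P K ≤ Real.exp (-(K : ℝ) ^ r)) :
    ∃ c : ℝ, 0 < c ∧ ∃ K₀ : ℕ, ∀ K : ℕ, K₀ ≤ K → P K ≤ 2 * Real.exp (-c * (K : ℝ) ^ r) := by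
  refine ⟨1, one_pos, eventually_atTop.1 (h.mono fun K hK => ?_)⟩
  rw [neg_one_mul]
  exact hK.trans (le_mul_of_one_le_left (Real.exp_pos _).le one_le_two)

end

end RWDRE

open RWDRE

theorem corollary4p3_general {T : Type} [CommSemiring T] [LinearOrder T] [IsStrictOrderedRing T]
    (E : RWDRE.Environment T)
    (ν : ℝ) (hν : 0 < ν) (hdrift : E.NoDriftingIn ν) (hcover : E.Covering ν)
    (p₀ p₁ : ℝ) (hp₀ : 0 ≤ p₀) (hp : p₀ ≤ p₁) (hp₁ : p₁ ≤ 1)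
    (ρ : ℝ) (hρ : ρ ∈ E.J) :
    ∃ vminus vplus : ℝ,
      E.IsLowerSpeed p₀ p₁ ρ vminus ∧ E.IsUpperSpeed p₀ p₁ ρ vplus ∧
      (∀ v < vminus, ∀ᶠ K : ℕ in atTop,
        (E.annealed ρ).real {ω | ∃ n : ℕ, (RWDRE.walk p₀ p₁ ω.1 ω.2 n : ℝ) < n * v - K}
          ≤ Real.exp (-(K : ℝ) ^ (1 / 1000 : ℝ))) ∧
      (∀ v > vplus, ∀ᶠ K : ℕ in atTop,
        (E.annealed ρ).real {ω | ∃ n : ℕ, (n * v + K : ℝ) < RWDRE.walk p₀ p₁ ω.1 ω.2 n}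
          ≤ Real.exp (-(K : ℝ) ^ (1 / 1000 : ℝ))) := by
  have hrates : JumpRates p₀ p₁ := ⟨hp₀, hp, hp₁⟩
  have hord := E.speedsOrdered hν hdrift hcover hrates
  obtain ⟨vminus, hminus⟩ := hord.exists_isLowerSpeed hρ
  obtain ⟨vplus, hplus⟩ := hord.exists_isUpperSpeed hρ
  exact ⟨vminus, vplus, hminus, hplus,
    fun v hv =>
      hminus.eventually_measureReal_exists_walk_lt_le hν hdrift hcover hrates hρ hv,
    fun v hv =>
      hplus.eventually_measureReal_exists_lt_walk_le hν hdrift hcover hrates hρ hv⟩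

theorem corollary4p3 {T : Type} [CommSemiring T] [LinearOrder T] [IsStrictOrderedRing T]
    [CanonicallyOrderedAdd T] (E : RWDRE.Environment T)
    (ν : ℝ) (hν : 0 < ν) (hdrift : E.NoDriftingIn ν) (hcover : E.Covering ν)
    (p₀ p₁ : ℝ) (hp₀ : 0 ≤ p₀) (hp : p₀ < p₁) (hp₁ : p₁ ≤ 1)
    (ρ : ℝ) (hρ : ρ ∈ E.J) :
    ∃ vminus vplus : ℝ,
      E.IsLowerSpeed p₀ p₁ ρ vminus ∧ E.IsUpperSpeed p₀ p₁ ρ vplus ∧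
      (∀ v ∈ Set.Ioo 0 vminus, ∃ c : ℝ, 0 < c ∧ ∃ K₀ : ℕ, ∀ K : ℕ, K₀ ≤ K →
        (E.annealed ρ).real {ω | ∃ n : ℕ, (RWDRE.walk p₀ p₁ ω.1 ω.2 n : ℝ) < n * v - K}
          ≤ 2 * Real.exp (-c * (K : ℝ) ^ (1 / 1000 : ℝ))) ∧
      (∀ v ∈ Set.Ioo vplus 1, ∃ c : ℝ, 0 < c ∧ ∃ K₀ : ℕ, ∀ K : ℕ, K₀ ≤ K →
        (E.annealed ρ).real {ω | ∃ n : ℕ, (n * v + K : ℝ) < RWDRE.walk p₀ p₁ ω.1 ω.2 n}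
          ≤ 2 * Real.exp (-c * (K : ℝ) ^ (1 / 1000 : ℝ))) := by
  obtain ⟨vminus, vplus, hminus, hplus, hlower, hupper⟩ :=
    corollary4p3_general E ν hν hdrift hcover p₀ p₁ hp₀ hp.le hp₁ ρ hρ
  exact ⟨vminus, vplus, hminus, hplus, fun v hv => exists_le_two_mul_exp (hlower v hv.2),
    fun v hv => exists_le_two_mul_exp (hupper v hv.1)⟩
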